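/- Let $\mathcal X,\mathcal Y$ be real Hilbert spaces, $f:\mathcal X\to\mathbb R$ convex and continuously differentiable, $A:\mathcal X\to\mathcal Y$ a bounded linear operator and $b\in\mathcal Y$. Let $\mathcal L(x,\lambda)=f(x)+\langle\lambda,Ax-b\rangle$ and assume that $\mathcal L$ has a saddle point, i.e. a point $(x^*,\lambda^*)$ with $\mathcal L(x^*,\lambda)\le\mathcal L(x^*,\lambda^*)\le\mathcal L(x,\lambda^*)$ for all $(x,\lambda)\in\mathcal X\times\mathcal Y$. Let $t_0>0$, $\alpha>1$, $0<q<1$, $\gamma>0$, $s>0$, $c>0$, $0<p<1$, and put $$\mathcal L_t(x,\lambda)=\mathcal L(x,\lambda)+\frac{c}{2t^p}\left(\|x\|^2-\|\lambda\|^2\right).$$ Let $m:[t_0,\infty)\to(0,\infty)$ be differentiable and non-increasing, twice differentiable for large $t$, and such that there are $k_1,k_2>0$ with $$\frac{\gamma}{t^{q+s}}\le m(t)\le\frac{k_1}{t^q},\qquad t|\dot m(t)|\le k_2m(t),\qquad t^2|\ddot m(t)|\le k_2m(t)\qquad\text{for all large } t.$$ Let $(x,\lambda):[t_0,\infty)\to\mathcal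 X\times\mathcal Y$ be a global (classical) solution of $$m(t)\ddot x(t)+\frac{\alpha}{t^q}\dot x(t)+\gamma\frac{d}{dt}\nabla_x\mathcal L_t(x(t),\lambda(t))+t^s\nabla_x\mathcal L_t(x(t),\lambda(t))=0,$$ $$\dot\lambda(t)-(\alpha-1)\left(t^{q+s}-\gamma qt^{q-1}\right)\nabla_\lambda\mathcal L_t\left(x(t)+\theta(t)\dot x(t),\lambda(t)\right)=0,$$ where $$\theta(t)=\frac{m(t)t^{2q+s}+\gamma t^q-2m(t)\gamma qt^{2q-1}-\gamma\dot m(t)t^{2q}}{(\alpha-1)(t^{q+s}-\gamma qt^{q-1})}$$ (the second equation being required at the times where this denominator is nonzero). For $t\ge t_0$ let $(x_t,\lambda_t)$ be the saddle point of $\mathcal L_t$. Put $$a(t)=m(t)t^{q+s}-2\gamma qm(t)t^{q-1}-\gamma\dot m(t)t^q+\gamma,\qquad b(t)=-(\alpha-1)\left(qm(t)t^{q-1}+\dot m(t)t^q-1\right),$$ $$\begin{aligned}\mathcal E(t)={}&a(t)t^q\left(\mathcal L_t(x(t),\lambda_t)-\mathcal L_t(x_t,\lambda_t)\right)\\&+\tfrac12\left\|(\alpha-1)(x(t)-x_t)+t^q\left(m(t)\dot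 x(t)+\gamma\nabla_x\mathcal L_t(x(t),\lambda(t))\right)\right\|^2\\&+\tfrac12b(t)\|x(t)-x_t\|^2+\tfrac12\|\lambda(t)-\lambda_t\|^2.\end{aligned}$$ Let $r=\max\{q,p-q-s\}$, let $a_1>0$, and let $M$ satisfy $0<M<\min\left\{\frac{3c}{4(2\alpha-1)},\,c(\alpha-1)-\frac1{a_1}\right\}$. Then there exist $\mathcal C_0\ge0$ and $T\ge t_0$ such that $\mathcal E$ is locally Lipschitz on $[T,\infty)$ and differentiable at almost every $t\ge T$, $\mathcal E$ is differentiable at each $t\ge T$ at which $t\mapsto(x_t,\lambda_t)$ is differentiable, and, at every $t\ge T$ at which $\mathcal E$ is differentiable, $$\dot{\mathcal E}(t)+\frac{M}{t^r}\mathcal E(t)\le\mathcal C_0\left(m(t)t^{3q+s+p-2}+m(t)t^{q+s-p-1}\right).$$ -/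

import Mathlib

open Set Filter Topology MeasureTheory
open scoped InnerProductSpace

/-- Time derivative of a function on `[t₀, ∞)` (one-sided at the endpoint `t₀`). -/
noncomputable def timeDeriv {V : Type*} [NormedAddCommGroup V] [NormedSpace ℝ V]
    (t₀ : ℝ) (g : ℝ → V) : ℝ → V :=
  derivWithin g (Ici t₀)

/-- `g` is differentiable at the time `t` of `[t₀, ∞)` (one-sided at the endpoint `t₀`). -/
def TimeDiffAt {V : Type*} [NormedAddCommGroup V] [NormedSpace ℝ V]
    (t₀ : ℝ) (g : ℝ → V) (t : ℝ) : Prop :=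
  DifferentiableWithinAt ℝ g (Ici t₀) t

/-- `(x, l)` is a saddle point of `L` (minimum in the first, maximum in the second variable). -/
def IsSaddlePoint {X Y : Type*} (L : X → Y → ℝ) (x : X) (l : Y) : Prop :=
  ∀ (x' : X) (l' : Y), L x l' ≤ L x l ∧ L x l ≤ L x' l

/-- The data of the problem `min f(x)` subject to `A x = b` and of the primal-dual
dynamical system. The conditions on the data are hypotheses of the theorem. -/
structure PDSystem (X Y : Type*) [NormedAddCommGroup X] [InnerProductSpace ℝ X]
    [NormedAddCommGroup Y] [InnerProductSpace ℝ Y] where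
  /-- objective function -/
  f : X → ℝ
  /-- constraint operator -/
  A : X →L[ℝ] Y
  /-- right-hand side of the constraint -/
  b : Y
  /-- viscous damping parameter -/
  α : ℝ
  /-- exponent of the viscous damping -/
  q : ℝ
  /-- Hessian-driven damping parameter -/
  γ : ℝ
  /-- exponent of the time scaling -/
  s : ℝ
  /-- Tikhonov regularization parameter -/
  c : ℝ
  /-- exponent of the Tikhonov regularization -/
  p : ℝ
  /-- initial time -/
  t₀ : ℝ
  /-- variable mass -/
  m : ℝ → ℝ

namespace PDSystem

variable {X Y : Type*} [NormedAddCommGroup X] [InnerProductSpace ℝ X] [CompleteSpace X]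
  [NormedAddCommGroup Y] [InnerProductSpace ℝ Y] [CompleteSpace Y]

/-- The Lagrangian `f(x) + ⟨l, A x - b⟩`. -/
noncomputable def lagrangian (S : PDSystem X Y) (x : X) (l : Y) : ℝ :=
  S.f x + ⟪l, S.A x - S.b⟫_ℝ

/-- The regularized Lagrangian `L_t`. -/
noncomputable def regLagrangian (S : PDSystem X Y) (t : ℝ) (x : X) (l : Y) : ℝ :=
  S.lagrangian x l + S.c / (2 * t ^ S.p) * (‖x‖ ^ 2 - ‖l‖ ^ 2)

/-- Gradient of `L_t` in the first variable. -/
noncomputable def gradX (S : PDSystem X Y) (t : ℝ) (x : X) (l : Y) : X :=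
  gradient (fun x' => S.regLagrangian t x' l) x

/-- Gradient of `L_t` in the second variable. -/
noncomputable def gradL (S : PDSystem X Y) (t : ℝ) (x : X) (l : Y) : Y :=
  gradient (fun l' => S.regLagrangian t x l') l

/-- First derivative of the mass. -/
noncomputable def mdot (S : PDSystem X Y) : ℝ → ℝ := timeDeriv S.t₀ S.m

/-- Second derivative of the mass. -/
noncomputable def mddot (S : PDSystem X Y) : ℝ → ℝ := timeDeriv S.t₀ S.mdot

/-- The factor `t^(q+s) - γ q t^(q-1)`. -/
noncomputable def dualScale (S : PDSystem X Y) (t : ℝ) : ℝ :=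
  t ^ (S.q + S.s) - S.γ * S.q * t ^ (S.q - 1)

/-- The extrapolation parameter. -/
noncomputable def theta (S : PDSystem X Y) (t : ℝ) : ℝ :=
  (S.m t * t ^ (2 * S.q + S.s) + S.γ * t ^ S.q - 2 * S.m t * S.γ * S.q * t ^ (2 * S.q - 1)
      - S.γ * S.mdot t * t ^ (2 * S.q))
    / ((S.α - 1) * S.dualScale t)

/-- `(x, l)` is a (classical) global solution on `[t₀, ∞)`: all derivatives occurring in the
system exist and both equations hold. The dual equation is required only at the times at
which the extrapolation parameter `theta` is defined, i.e. has a nonzero denominator. -/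
structure IsGlobalSolution (S : PDSystem X Y) (x : ℝ → X) (l : ℝ → Y) : Prop where
  diff_x : ∀ t, S.t₀ ≤ t → TimeDiffAt S.t₀ x t
  diff_xdot : ∀ t, S.t₀ ≤ t → TimeDiffAt S.t₀ (timeDeriv S.t₀ x) t
  diff_l : ∀ t, S.t₀ ≤ t → TimeDiffAt S.t₀ l t
  diff_grad : ∀ t, S.t₀ ≤ t → TimeDiffAt S.t₀ (fun τ => S.gradX τ (x τ) (l τ)) t
  primal : ∀ t, S.t₀ ≤ t →
    S.m t • timeDeriv S.t₀ (timeDeriv S.t₀ x) t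
      + (S.α / t ^ S.q) • timeDeriv S.t₀ x t
      + S.γ • timeDeriv S.t₀ (fun τ => S.gradX τ (x τ) (l τ)) t
      + t ^ S.s • S.gradX t (x t) (l t) = 0
  dual : ∀ t, S.t₀ ≤ t → S.dualScale t ≠ 0 →
    timeDeriv S.t₀ l t
      - ((S.α - 1) * S.dualScale t) •
          S.gradL t (x t + S.theta t • timeDeriv S.t₀ x t) (l t) = 0

/-- The coefficient `a(t)` of the energy. -/
noncomputable def coefA (S : PDSystem X Y) (t : ℝ) : ℝ :=
  S.m t * t ^ (S.q + S.s) - 2 * S.γ * S.q * S.m t * t ^ (S.q - 1)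
    - S.γ * S.mdot t * t ^ S.q + S.γ

/-- The coefficient `b(t)` of the energy. -/
noncomputable def coefB (S : PDSystem X Y) (t : ℝ) : ℝ :=
  -(S.α - 1) * (S.q * S.m t * t ^ (S.q - 1) + S.mdot t * t ^ S.q - 1)

/-- The energy along a trajectory `(x, l)`, relative to the curve `(xs, ls)` of saddle points. -/
noncomputable def energy (S : PDSystem X Y) (x : ℝ → X) (l : ℝ → Y) (xs : ℝ → X) (ls : ℝ → Y)
    (t : ℝ) : ℝ :=
  S.coefA t * t ^ S.q * (S.regLagrangian t (x t) (ls t) - S.regLagrangian t (xs t) (ls t))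
    + 1 / 2 * ‖(S.α - 1) • (x t - xs t)
        + t ^ S.q • (S.m t • timeDeriv S.t₀ x t + S.γ • S.gradX t (x t) (l t))‖ ^ 2
    + 1 / 2 * S.coefB t * ‖x t - xs t‖ ^ 2
    + 1 / 2 * ‖l t - ls t‖ ^ 2

/-- Two-sided bound on the mass for large times. -/
def MassBound (S : PDSystem X Y) : Prop :=
  ∃ k₁ : ℝ, 0 < k₁ ∧ ∀ᶠ t in atTop,
    S.γ / t ^ (S.q + S.s) ≤ S.m t ∧ S.m t ≤ k₁ / t ^ S.q

/-- Bounds on the first two derivatives of the mass for large times (in particular, the mass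
is twice differentiable at large times). -/
def MassDerivBound (S : PDSystem X Y) : Prop :=
  ∃ k₂ : ℝ, 0 < k₂ ∧ ∀ᶠ t in atTop,
    TimeDiffAt S.t₀ S.mdot t ∧
      t * |S.mdot t| ≤ k₂ * S.m t ∧ t ^ 2 * |S.mddot t| ≤ k₂ * S.m t

end PDSystem

/-! Write ε = c/t^p, D for `dualScale`, and β = q m t^(q-1) + ṁ t^q - 1; the energy has coefficients
a = mD - γβ and b = -(α-1)β. With a frozen saddle point, differentiating the energy along the system
makes all cross terms between velocity, gradient and multiplier cancel (`inner_cancellation`). By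
strong convexity of L_t what survives is, up to small corrections, a negative combination of the
gap, ε‖x - x_t‖², ‖ẋ‖², ‖∇ₓL_t‖² and ε‖λ - λ_t‖². For large t this dominates M/t^max(q, p-q-s) times
the energy: the gap, velocity and gradient terms need a factor at most M/t^q, the two distance terms
one at most M t^(q+s-p), whence the maximum.

The saddle curve need not be differentiable where the energy is. Optimality conditions and
monotonicity of ∇f show that it is bounded and Lipschitz with constant R/t (`exists_saddle_bounds`).
For τ ≥ t the energy therefore lies below a function that is differentiable at t and touches it
there, built from the frozen saddle point, a lower bound of the saddle value and a Lipschitz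
remainder; comparing right difference quotients bounds the derivative (`deriv_energy_le_formal`).

The motion of the saddle point and the variation of ε cost terms linear in the distances and norms.
Young's inequality pays for them out of the unused negative quadratic terms and leaves a multiple of
m t^(3q+s+p-2) (`LargeTime.energy_inequality`). Regularity holds because the energy is a C¹ function
of nine curves, each Lipschitz near every large time. -/

/-- First-order characterization of convexity. -/
theorem ConvexOn.le_sub_of_hasGradientAt {E : Type*} [NormedAddCommGroup E]
    [InnerProductSpace ℝ E] [CompleteSpace E] {f : E → ℝ} (hf : ConvexOn ℝ univ f) {x g : E}
    (hg : HasGradientAt f g x) (y : E) : ⟪g, y - x⟫_ℝ ≤ f y - f x := by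
  have hφ : ConvexOn ℝ univ (f ∘ AffineMap.lineMap (k := ℝ) x y) := by
    simpa using hf.comp_affineMap (AffineMap.lineMap (k := ℝ) x y)
  have hd : HasDerivAt (f ∘ AffineMap.lineMap (k := ℝ) x y) ⟪g, y - x⟫_ℝ 0 := by
    have h1 : HasFDerivAt f (InnerProductSpace.toDual ℝ E g)
        (AffineMap.lineMap (k := ℝ) x y (0 : ℝ)) := by
      simpa using hg.hasFDerivAt
    simpa using h1.comp_hasDerivAt (0 : ℝ) (AffineMap.hasDerivAt_lineMap (a := x) (b := y))
  have := hφ.le_slope_of_hasDerivAt (mem_univ 0) (mem_univ 1) one_pos hd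
  simpa [slope_def_field] using this

theorem HasGradientAt.eq_zero_of_isLocalExtr {E : Type*} [NormedAddCommGroup E]
    [InnerProductSpace ℝ E] [CompleteSpace E] {f : E → ℝ} {x g : E}
    (hg : HasGradientAt f g x) (h : IsLocalExtr f x) : g = 0 := by
  have := h.hasFDerivAt_eq_zero hg.hasFDerivAt
  simpa using this

/-! ### Saddle points of the regularized Lagrangians. -/

namespace PDSystem

set_option linter.unusedSectionVars false

variable {X Y : Type*} [NormedAddCommGroup X] [InnerProductSpace ℝ X] [CompleteSpace X]
  [NormedAddCommGroup Y] [InnerProductSpace ℝ Y] [CompleteSpace Y]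

/-- The Tikhonov parameter `c / t ^ p`. -/
noncomputable def tikh (S : PDSystem X Y) (t : ℝ) : ℝ := S.c / t ^ S.p

theorem regLagrangian_eq (S : PDSystem X Y) (t : ℝ) (x : X) (l : Y) :
    S.regLagrangian t x l
      = S.f x + ⟪l, S.A x - S.b⟫_ℝ + S.tikh t / 2 * (‖x‖ ^ 2 - ‖l‖ ^ 2) := by
  rw [regLagrangian, lagrangian, tikh]
  congr 2
  rw [mul_comm 2, div_mul_eq_div_div]

/-- The Lagrangian with the quadratic regularization of weight `ε`. -/
noncomputable def pertLagrangian (S : PDSystem X Y) (ε : ℝ) (x : X) (l : Y) : ℝ :=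
  S.f x + ⟪l, S.A x - S.b⟫_ℝ + ε / 2 * (‖x‖ ^ 2 - ‖l‖ ^ 2)

/-- Indexing by the weight ε instead of time lets the same lemmas compare two times, or one time
with the unregularized problem ε = 0. -/
theorem regLagrangian_eq_pertLagrangian (S : PDSystem X Y) (t : ℝ) :
    S.regLagrangian t = S.pertLagrangian (S.tikh t) := by
  funext x l
  rw [regLagrangian_eq, pertLagrangian]

theorem lagrangian_eq_pertLagrangian (S : PDSystem X Y) :
    S.lagrangian = S.pertLagrangian 0 := by
  funext x l
  simp [lagrangian, pertLagrangian]

theorem hasGradientAt_pertLagrangian_left (S : PDSystem X Y) (hf : ContDiff ℝ 1 S.f)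
    (ε : ℝ) (x : X) (l : Y) :
    HasGradientAt (fun x' => S.pertLagrangian ε x' l)
      (gradient S.f x + S.A.adjoint l + ε • x) x := by
  have h1 : HasFDerivAt S.f (InnerProductSpace.toDual ℝ X (gradient S.f x)) x :=
    (hf.differentiable one_ne_zero x).hasGradientAt.hasFDerivAt
  have h2 : HasFDerivAt (fun x' => ⟪l, S.A x' - S.b⟫_ℝ) ((innerSL ℝ l).comp S.A) x :=
    (innerSL ℝ l).hasFDerivAt.comp x (S.A.hasFDerivAt.sub_const S.b)
  have h3 := ((hasStrictFDerivAt_norm_sq x).hasFDerivAt.sub_const (‖l‖ ^ 2)).const_mul (ε / 2)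
  rw [hasGradientAt_iff_hasFDerivAt]
  refine ((h1.add h2).add h3).congr_fderiv ?_
  ext v
  simp [ContinuousLinearMap.adjoint_inner_left]
  ring

theorem hasGradientAt_pertLagrangian_right (S : PDSystem X Y)
    (ε : ℝ) (x : X) (l : Y) :
    HasGradientAt (fun l' => S.pertLagrangian ε x l') (S.A x - S.b - ε • l) l := by
  have h2 : HasFDerivAt (fun l' => ⟪l', S.A x - S.b⟫_ℝ) (innerSL ℝ (S.A x - S.b)) l := by
    refine (innerSL ℝ (S.A x - S.b)).hasFDerivAt.congr_of_eventuallyEq (Eventually.of_forall ?_)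
    intro l'
    exact real_inner_comm _ _
  have h3 := ((hasStrictFDerivAt_norm_sq l).hasFDerivAt.const_sub (‖x‖ ^ 2)).const_mul (ε / 2)
  rw [hasGradientAt_iff_hasFDerivAt]
  refine ((h2.const_add (S.f x)).add h3).congr_fderiv ?_
  ext v
  simp
  ring

theorem gradX_eq (S : PDSystem X Y) (hf : ContDiff ℝ 1 S.f) (t : ℝ) (x : X) (l : Y) :
    S.gradX t x l = gradient S.f x + S.A.adjoint l + S.tikh t • x := by
  rw [gradX, regLagrangian_eq_pertLagrangian]
  exact (S.hasGradientAt_pertLagrangian_left hf _ x l).gradient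

theorem gradL_eq (S : PDSystem X Y) (t : ℝ) (x : X) (l : Y) :
    S.gradL t x l = S.A x - S.b - S.tikh t • l := by
  rw [gradL, regLagrangian_eq_pertLagrangian]
  exact (S.hasGradientAt_pertLagrangian_right _ x l).gradient

theorem kkt_left (S : PDSystem X Y) (hf : ContDiff ℝ 1 S.f) {ε : ℝ} {x : X} {l : Y}
    (h : IsSaddlePoint (S.pertLagrangian ε) x l) :
    gradient S.f x + S.A.adjoint l + ε • x = 0 :=
  (S.hasGradientAt_pertLagrangian_left hf ε x l).eq_zero_of_isLocalExtr
    (Or.inl (Eventually.of_forall fun x' => (h x' l).2))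

theorem kkt_right (S : PDSystem X Y) {ε : ℝ} {x : X} {l : Y}
    (h : IsSaddlePoint (S.pertLagrangian ε) x l) : S.A x - S.b - ε • l = 0 :=
  (S.hasGradientAt_pertLagrangian_right ε x l).eq_zero_of_isLocalExtr
    (Or.inr (Eventually.of_forall fun l' => (h x l').1))

/-- Strong convexity of the regularized Lagrangian in the first variable. -/
theorem inner_gradient_ge (S : PDSystem X Y) (hfc : ConvexOn ℝ univ S.f) (hf : ContDiff ℝ 1 S.f)
    (ε : ℝ) (x y : X) (l : Y) :
    S.pertLagrangian ε x l - S.pertLagrangian ε y l + ε / 2 * ‖x - y‖ ^ 2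
      ≤ ⟪x - y, gradient S.f x + S.A.adjoint l + ε • x⟫_ℝ := by
  have h := hfc.le_sub_of_hasGradientAt (hf.differentiable one_ne_zero x).hasGradientAt y
  have h2 : ⟪gradient S.f x, y - x⟫_ℝ = - ⟪x - y, gradient S.f x⟫_ℝ := by
    rw [real_inner_comm, ← neg_sub x y, inner_neg_left]
  rw [h2] at h
  simp only [pertLagrangian, inner_add_right, ContinuousLinearMap.adjoint_inner_right,
    inner_smul_right, map_sub, inner_sub_left, inner_sub_right, norm_sub_sq_real,
    real_inner_self_eq_norm_sq] at h ⊢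
  rw [real_inner_comm l (S.A x), real_inner_comm l (S.A y), real_inner_comm x y]
  linarith

/-- Strong convexity at a saddle point. -/
theorem saddle_gap_ge (S : PDSystem X Y) (hfc : ConvexOn ℝ univ S.f) (hf : ContDiff ℝ 1 S.f)
    {ε : ℝ} {y : X} {l : Y} (h : IsSaddlePoint (S.pertLagrangian ε) y l) (x : X) :
    ε / 2 * ‖x - y‖ ^ 2 ≤ S.pertLagrangian ε x l - S.pertLagrangian ε y l := by
  have := S.inner_gradient_ge hfc hf ε y x l
  rw [S.kkt_left hf h, inner_zero_right, norm_sub_rev] at this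
  linarith

theorem gradient_monotone {E : Type*} [NormedAddCommGroup E]
    [InnerProductSpace ℝ E] [CompleteSpace E] {f : E → ℝ} (hfc : ConvexOn ℝ univ f)
    (hf : ContDiff ℝ 1 f) (x y : E) : 0 ≤ ⟪gradient f x - gradient f y, x - y⟫_ℝ := by
  have h1 := hfc.le_sub_of_hasGradientAt (hf.differentiable one_ne_zero x).hasGradientAt y
  have h2 := hfc.le_sub_of_hasGradientAt (hf.differentiable one_ne_zero y).hasGradientAt x
  rw [← neg_sub x y, inner_neg_right] at h1
  rw [inner_sub_left]
  linarith

/-- Subtract the two optimality systems: the coupling through A is skew and cancels, and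
monotonicity of ∇f gives the sign. -/
theorem saddle_monotone (S : PDSystem X Y) (hfc : ConvexOn ℝ univ S.f) (hf : ContDiff ℝ 1 S.f)
    {ε ε' : ℝ} {x x' : X} {l l' : Y} (h : IsSaddlePoint (S.pertLagrangian ε) x l)
    (h' : IsSaddlePoint (S.pertLagrangian ε') x' l') :
    ⟪ε • x - ε' • x', x - x'⟫_ℝ + ⟪ε • l - ε' • l', l - l'⟫_ℝ ≤ 0 := by
  have e1 : gradient S.f x = - (S.A.adjoint l) - ε • x := by
    have := S.kkt_left hf h
    rw [← sub_eq_zero, ← this]; abel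
  have e2 : gradient S.f x' = - (S.A.adjoint l') - ε' • x' := by
    have := S.kkt_left hf h'
    rw [← sub_eq_zero, ← this]; abel
  have e3 : ε • l - ε' • l' = S.A (x - x') := by
    have h1 := sub_eq_zero.1 (S.kkt_right h)
    have h2 := sub_eq_zero.1 (S.kkt_right h')
    rw [← h1, ← h2, map_sub]; abel
  have hm := gradient_monotone hfc hf x x'
  rw [e1, e2] at hm
  have e4 : - (S.A.adjoint l) - ε • x - (- (S.A.adjoint l') - ε' • x')
      = - S.A.adjoint (l - l') - (ε • x - ε' • x') := by rw [map_sub]; abel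
  rw [e4, inner_sub_left, inner_neg_left, ContinuousLinearMap.adjoint_inner_left] at hm
  rw [e3, real_inner_comm]
  rw [real_inner_comm] at hm
  linarith [real_inner_comm (l - l') (S.A (x - x')),
    real_inner_comm (x - x') (ε • x - ε' • x')]

/-- The saddle point of a regularized Lagrangian is no longer than any saddle point of
the Lagrangian. -/
theorem saddle_norm_sq_le (S : PDSystem X Y) (hfc : ConvexOn ℝ univ S.f) (hf : ContDiff ℝ 1 S.f)
    {ε : ℝ} (hε : 0 < ε) {x x' : X} {l l' : Y} (h : IsSaddlePoint (S.pertLagrangian ε) x l)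
    (h' : IsSaddlePoint S.lagrangian x' l') :
    ‖x‖ ^ 2 + ‖l‖ ^ 2 ≤ ‖x'‖ ^ 2 + ‖l'‖ ^ 2 := by
  rw [lagrangian_eq_pertLagrangian] at h'
  have hm := S.saddle_monotone hfc hf h h'
  simp only [zero_smul, sub_zero, inner_smul_left, inner_sub_right, real_inner_self_eq_norm_sq,
    conj_trivial] at hm
  -- The second weight is 0, so the positive factor ε can be divided out; Cauchy–Schwarz then
  -- compares the norms.
  have h3 : ‖x‖ ^ 2 - ⟪x, x'⟫_ℝ + (‖l‖ ^ 2 - ⟪l, l'⟫_ℝ) ≤ 0 := by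
    by_contra hc
    push Not at hc
    nlinarith [mul_pos hε hc]
  have h4 := real_inner_le_norm x x'
  have h5 := real_inner_le_norm l l'
  nlinarith [sq_nonneg (‖x‖ - ‖x'‖), sq_nonneg (‖l‖ - ‖l'‖)]

/-- With z the difference of the two saddle points and w the second one, monotonicity reads ⟪εz + (ε
- ε')w, z⟫ ≤ 0, hence ε‖z‖ ≤ |ε - ε'|‖w‖. -/
theorem saddle_dist_sq_le (S : PDSystem X Y) (hfc : ConvexOn ℝ univ S.f) (hf : ContDiff ℝ 1 S.f)
    {ε ε' : ℝ} (hε : 0 ≤ ε) {x x' : X} {l l' : Y} (h : IsSaddlePoint (S.pertLagrangian ε) x l)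
    (h' : IsSaddlePoint (S.pertLagrangian ε') x' l') :
    ε ^ 2 * (‖x' - x‖ ^ 2 + ‖l' - l‖ ^ 2) ≤ (ε - ε') ^ 2 * (‖x'‖ ^ 2 + ‖l'‖ ^ 2) := by
  have hm := S.saddle_monotone hfc hf h h'
  have e1 : ε • x - ε' • x' = ε • (x - x') + (ε - ε') • x' := by module
  have e2 : ε • l - ε' • l' = ε • (l - l') + (ε - ε') • l' := by module
  rw [e1, e2, inner_add_left, inner_add_left] at hm
  simp only [inner_smul_left, real_inner_self_eq_norm_sq, conj_trivial] at hm
  have n1 := norm_add_sq_real (ε • (x - x')) ((ε - ε') • x')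
  have n2 := norm_add_sq_real (ε • (l - l')) ((ε - ε') • l')
  simp only [norm_smul, inner_smul_left, inner_smul_right, conj_trivial, mul_pow,
    Real.norm_eq_abs, sq_abs] at n1 n2
  rw [norm_sub_rev x', norm_sub_rev l']
  rw [real_inner_comm (x - x') x', real_inner_comm (l - l') l'] at hm
  nlinarith [sq_nonneg ‖ε • (x - x') + (ε - ε') • x'‖, sq_nonneg ‖ε • (l - l') + (ε - ε') • l'‖,
    mul_nonneg hε (neg_nonneg.2 hm)]

theorem tikh_pos (S : PDSystem X Y) (hc : 0 < S.c) {t : ℝ} (ht : 0 < t) : 0 < S.tikh t :=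
  div_pos hc (Real.rpow_pos_of_pos ht _)

theorem tikh_eq (S : PDSystem X Y) {t : ℝ} (ht : 0 < t) : S.tikh t = S.c * t ^ (-S.p) := by
  rw [tikh, Real.rpow_neg ht.le, div_eq_mul_inv]

theorem tikh_anti (S : PDSystem X Y) (hc : 0 < S.c) (hp₀ : 0 < S.p) {t τ : ℝ} (ht : 0 < t)
    (hτ : t ≤ τ) : S.tikh τ ≤ S.tikh t :=
  div_le_div_of_nonneg_left hc.le (Real.rpow_pos_of_pos ht _)
    (Real.rpow_le_rpow ht.le hτ hp₀.le)

/-- Since p < 1, (t/τ)^p ≥ t/τ ≥ 1 - (τ-t)/t. This relative variation of ε is the source of the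
Lipschitz constant R/t. -/
theorem tikh_sub_le (S : PDSystem X Y) (hc : 0 < S.c) (hp₁ : S.p < 1)
    {t τ : ℝ} (ht : 0 < t) (hτ : t ≤ τ) :
    S.tikh t - S.tikh τ ≤ S.tikh t * ((τ - t) / t) := by
  have hτ0 := ht.trans_le hτ
  have h1 : t / τ ≤ (t / τ) ^ S.p := by
    have := Real.rpow_le_rpow_of_exponent_ge (div_pos ht hτ0) ((div_le_one hτ0).2 hτ) hp₁.le
    simpa using this
  have h2 : S.tikh τ = S.tikh t * (t / τ) ^ S.p := by
    have := (Real.rpow_pos_of_pos ht S.p).ne'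
    rw [tikh, tikh, Real.div_rpow ht.le hτ0.le]
    field_simp
  have h3 : 1 - (τ - t) / t ≤ t / τ := by
    rw [le_div_iff₀ hτ0, sub_mul, div_mul_eq_mul_div, one_mul, sub_le_iff_le_add,
      ← sub_le_iff_le_add', le_div_iff₀ ht]
    nlinarith
  have h4 := mul_le_mul_of_nonneg_left (h3.trans h1) (S.tikh_pos hc ht).le
  rw [h2]
  linarith

section Curve

variable {S : PDSystem X Y} {xs : ℝ → X} {ls : ℝ → Y}

/-- The saddle points of the regularized Lagrangians are bounded and depend on time in a
Lipschitz manner with constant of order `1 / t`. -/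
theorem exists_saddle_bounds (hfc : ConvexOn ℝ univ S.f) (hf : ContDiff ℝ 1 S.f)
    (hΩ : ∃ (xbar : X) (lbar : Y), IsSaddlePoint S.lagrangian xbar lbar)
    (ht₀ : 0 < S.t₀) (hc : 0 < S.c) (hp₀ : 0 < S.p) (hp₁ : S.p < 1)
    (hsaddle : ∀ t, S.t₀ ≤ t → IsSaddlePoint (S.regLagrangian t) (xs t) (ls t)) :
    ∃ R : ℝ, 0 ≤ R ∧ (∀ t, S.t₀ ≤ t → ‖xs t‖ ≤ R) ∧ ∀ t τ, S.t₀ ≤ t → t ≤ τ →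
      ‖xs τ - xs t‖ ≤ R / t * (τ - t) ∧ ‖ls τ - ls t‖ ≤ R / t * (τ - t) := by
  obtain ⟨x', l', h'⟩ := hΩ
  simp only [regLagrangian_eq_pertLagrangian] at hsaddle
  have hN : 0 ≤ ‖x'‖ ^ 2 + ‖l'‖ ^ 2 := by positivity
  have hb : ∀ t, S.t₀ ≤ t → ‖xs t‖ ^ 2 + ‖ls t‖ ^ 2 ≤ ‖x'‖ ^ 2 + ‖l'‖ ^ 2 := fun t ht =>
    S.saddle_norm_sq_le hfc hf (S.tikh_pos hc (ht₀.trans_le ht)) (hsaddle t ht) h'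
  -- R is the norm of one fixed saddle point of the unregularized Lagrangian.
  refine ⟨√(‖x'‖ ^ 2 + ‖l'‖ ^ 2), Real.sqrt_nonneg _, fun t ht => ?_, fun t τ ht hτ => ?_⟩
  · exact Real.le_sqrt_of_sq_le (by nlinarith [hb t ht, sq_nonneg ‖ls t‖])
  · have ht' := ht₀.trans_le ht
    have he := S.tikh_pos hc ht'
    have hs := S.tikh_sub_le hc hp₁ ht' hτ
    have hs0 := sub_nonneg.2 (S.tikh_anti hc hp₀ ht' hτ)
    have hd := S.saddle_dist_sq_le hfc hf he.le (hsaddle t ht) (hsaddle τ (ht.trans hτ))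
    have h1 : ‖xs τ - xs t‖ ^ 2 + ‖ls τ - ls t‖ ^ 2
        ≤ (√(‖x'‖ ^ 2 + ‖l'‖ ^ 2) / t * (τ - t)) ^ 2 := by
      have h2 : (S.tikh t - S.tikh τ) ^ 2 ≤ (S.tikh t * ((τ - t) / t)) ^ 2 :=
        pow_le_pow_left₀ hs0 hs 2
      have h3 : S.tikh t ^ 2 * (‖xs τ - xs t‖ ^ 2 + ‖ls τ - ls t‖ ^ 2)
          ≤ S.tikh t ^ 2 * (((τ - t) / t) ^ 2 * (‖x'‖ ^ 2 + ‖l'‖ ^ 2)) := by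
        refine hd.trans ?_
        rw [← mul_assoc, ← mul_pow]
        exact mul_le_mul h2 (hb τ (ht.trans hτ)) (by positivity) (by positivity)
      have h4 := le_of_mul_le_mul_left h3 (by positivity)
      rw [mul_pow, div_pow, Real.sq_sqrt hN]
      rw [div_pow] at h4
      exact h4.trans_eq (by ring)
    have hnn : 0 ≤ √(‖x'‖ ^ 2 + ‖l'‖ ^ 2) / t * (τ - t) :=
      mul_nonneg (by positivity) (sub_nonneg.2 hτ)
    exact ⟨(pow_le_pow_iff_left₀ (norm_nonneg _) hnn two_ne_zero).1 (by nlinarith [sq_nonneg ‖ls τ - ls t‖]),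
      (pow_le_pow_iff_left₀ (norm_nonneg _) hnn two_ne_zero).1 (by nlinarith [sq_nonneg ‖xs τ - xs t‖])⟩

/-- One-sided comparison of the saddle values at two times. -/
theorem saddle_value_ge (S : PDSystem X Y) {ε ε' : ℝ} {x x' : X} {l l' : Y}
    (h : IsSaddlePoint (S.pertLagrangian ε) x l)
    (h' : IsSaddlePoint (S.pertLagrangian ε') x' l') :
    S.pertLagrangian ε x l + (ε' - ε) / 2 * (‖x'‖ ^ 2 - ‖l‖ ^ 2) ≤ S.pertLagrangian ε' x' l' := by
  -- Both saddle inequalities are tested at the mixed pair (x', l).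
  have h1 := (h x' l).2
  have h2 := (h' x l).1
  refine le_trans ?_ h2
  refine le_trans (add_le_add_left h1 _) (le_of_eq ?_)
  simp only [pertLagrangian]
  ring

end Curve

end PDSystem

/-! ### Local Lipschitz continuity and one-sided comparison of derivatives. -/

/-- `g` is Lipschitz on a neighbourhood of `t`. -/
def LipschitzNear {V : Type*} [NormedAddCommGroup V] (g : ℝ → V) (t : ℝ) : Prop :=
  ∃ K : NNReal, ∃ u ∈ 𝓝 t, LipschitzOnWith K g u

namespace LipschitzNear

variable {V W : Type*} [NormedAddCommGroup V] [NormedAddCommGroup W]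

theorem continuousAt {g : ℝ → V} {t : ℝ} (h : LipschitzNear g t) : ContinuousAt g t := by
  obtain ⟨K, u, hu, hg⟩ := h
  exact hg.continuousOn.continuousAt hu

theorem prodMk {g : ℝ → V} {k : ℝ → W} {t : ℝ} (hg : LipschitzNear g t)
    (hk : LipschitzNear k t) : LipschitzNear (fun τ => (g τ, k τ)) t := by
  obtain ⟨K, u, hu, hg⟩ := hg
  obtain ⟨K', v, hv, hk⟩ := hk
  exact ⟨max K K', u ∩ v, inter_mem hu hv,
    (hg.mono inter_subset_left).prodMk (hk.mono inter_subset_right)⟩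

theorem contDiff_comp [NormedSpace ℝ V] [NormedSpace ℝ W] {Φ : V → W} (hΦ : ContDiff ℝ 1 Φ)
    {g : ℝ → V} {t : ℝ} (hg : LipschitzNear g t) : LipschitzNear (fun τ => Φ (g τ)) t := by
  have hc := hg.continuousAt
  obtain ⟨K, u, hu, hg⟩ := hg
  obtain ⟨K', v, hv, hΦ⟩ := (hΦ.contDiffAt (x := g t)).exists_lipschitzOnWith
  exact ⟨K' * K, u ∩ g ⁻¹' v, inter_mem hu (hc.preimage_mem_nhds hv),
    hΦ.comp (hg.mono inter_subset_left) fun _ h => h.2⟩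

theorem of_hasDerivAt_le [NormedSpace ℝ V] {g g' : ℝ → V} {t K : ℝ}
    (h : ∀ᶠ τ in 𝓝 t, HasDerivAt g (g' τ) τ ∧ ‖g' τ‖ ≤ K) : LipschitzNear g t := by
  obtain ⟨δ, hδ, hb⟩ := Metric.eventually_nhds_iff_ball.1 h
  refine ⟨K.toNNReal, Metric.ball t δ, Metric.ball_mem_nhds t hδ, ?_⟩
  refine (convex_ball t δ).lipschitzOnWith_of_nnnorm_hasDerivWithin_le
    (fun τ hτ => (hb τ hτ).1.hasDerivWithinAt) fun τ hτ => ?_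
  rw [← norm_toNNReal]
  exact Real.toNNReal_le_toNNReal (hb τ hτ).2

theorem of_hasDerivAt [NormedSpace ℝ V] {g g' : ℝ → V} {t : ℝ}
    (h : ∀ᶠ τ in 𝓝 t, HasDerivAt g (g' τ) τ) (hc : ContinuousAt g' t) : LipschitzNear g t := by
  refine of_hasDerivAt_le (g' := g') (K := ‖g' t‖ + 1) (h.and ?_)
  exact (hc.norm.eventually_lt_const (lt_add_one _)).mono fun _ => le_of_lt

theorem of_forall_ge {g : ℝ → V} {t T K : ℝ} (hT : T < t)
    (h : ∀ τ τ', T ≤ τ → τ ≤ τ' → ‖g τ' - g τ‖ ≤ K * (τ' - τ)) : LipschitzNear g t := by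
  refine ⟨K.toNNReal, Ici T, Ici_mem_nhds hT, LipschitzOnWith.of_dist_le_mul ?_⟩
  have key : ∀ τ ∈ Ici T, ∀ τ' ∈ Ici T, τ ≤ τ' → dist (g τ) (g τ') ≤ K.toNNReal * dist τ τ' := by
    intro τ hτ τ' _ hle
    rw [dist_comm, dist_eq_norm, dist_comm τ, Real.dist_eq, abs_of_nonneg (sub_nonneg.2 hle)]
    exact (h τ τ' hτ hle).trans
      (mul_le_mul_of_nonneg_right (Real.le_coe_toNNReal K) (sub_nonneg.2 hle))
  intro τ hτ τ' hτ'
  rcases le_total τ τ' with hle | hle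
  · exact key τ hτ τ' hτ' hle
  · rw [dist_comm, dist_comm τ]
    exact key τ' hτ' τ hτ hle

end LipschitzNear

theorem locallyLipschitzOn_of_lipschitzNear {V : Type*} [NormedAddCommGroup V] {g : ℝ → V}
    {s : Set ℝ} (h : ∀ t ∈ s, LipschitzNear g t) : LocallyLipschitzOn s g := by
  intro t ht
  obtain ⟨K, u, hu, hg⟩ := h t ht
  exact ⟨K, u, mem_nhdsWithin_of_mem_nhds hu, hg⟩

/-- Rademacher's theorem for locally Lipschitz real functions of a real variable. -/
theorem ae_differentiableAt_of_lipschitzNear {g : ℝ → ℝ} {s : Set ℝ}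
    (h : ∀ t ∈ s, LipschitzNear g t) : ∀ᵐ t : ℝ, t ∈ s → DifferentiableAt ℝ g t := by
  rw [ae_iff]
  refine measure_null_of_locally_null _ fun t ht => ?_
  simp only [Classical.not_imp, mem_ofPred_eq] at ht
  obtain ⟨K, u, hu, hg⟩ := h t ht.1
  obtain ⟨v, hvu, hv, htv⟩ := mem_nhds_iff.1 hu
  refine ⟨{a | ¬(a ∈ s → DifferentiableAt ℝ g a)} ∩ v,
    inter_mem_nhdsWithin _ (hv.mem_nhds htv), ?_⟩
  have hae := (hg.mono hvu).ae_differentiableWithinAt_of_mem_real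
  rw [ae_iff] at hae
  refine measure_mono_null (fun a ha => ?_) hae
  simp only [Classical.not_imp, mem_inter_iff, mem_ofPred_eq] at ha ⊢
  exact ⟨ha.2, fun hd => ha.1.2 (hd.differentiableAt (hv.mem_nhds ha.2))⟩

theorem TimeDiffAt.hasDerivAt {V : Type*} [NormedAddCommGroup V] [NormedSpace ℝ V] {t₀ t : ℝ}
    {g : ℝ → V} (h : TimeDiffAt t₀ g t) (ht : t₀ < t) : HasDerivAt g (timeDeriv t₀ g t) t :=
  (DifferentiableWithinAt.hasDerivWithinAt h).hasDerivAt (Ici_mem_nhds ht)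

theorem timeDiffAt_iff {V : Type*} [NormedAddCommGroup V] [NormedSpace ℝ V] {t₀ t : ℝ}
    {g : ℝ → V} (ht : t₀ < t) : TimeDiffAt t₀ g t ↔ DifferentiableAt ℝ g t :=
  ⟨fun h => (h.hasDerivAt ht).differentiableAt, fun h => h.differentiableWithinAt⟩

/-- A function vanishing at `t` times a function continuous at `t`. -/
theorem HasDerivAt.mul_continuousAt {g k : ℝ → ℝ} {g' t : ℝ} (hg : HasDerivAt g g' t)
    (h0 : g t = 0) (hk : ContinuousAt k t) : HasDerivAt (fun τ => g τ * k τ) (g' * k t) t := by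
  rw [hasDerivAt_iff_tendsto_slope] at hg ⊢
  refine (hg.mul (hk.tendsto.mono_left nhdsWithin_le_nhds)).congr fun τ => ?_
  simp only [slope_def_field, h0]
  ring

/-- Comparison of derivatives from one-sided comparison of functions. -/
theorem HasDerivAt.le_of_le_right {g k : ℝ → ℝ} {g' k' t : ℝ} (hg : HasDerivAt g g' t)
    (hk : HasDerivAt k k' t) (h0 : g t = k t) (h : ∀ τ, t ≤ τ → g τ ≤ k τ) : g' ≤ k' := by
  have hd := (hk.sub hg).hasDerivWithinAt (s := Ioi t)
  rw [hasDerivWithinAt_iff_tendsto_slope' (by simp)] at hd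
  have : 0 ≤ k' - g' := by
    refine ge_of_tendsto hd ?_
    filter_upwards [self_mem_nhdsWithin] with τ hτ
    simp only [slope_def_field, Pi.sub_apply, h0, sub_self, sub_zero]
    exact div_nonneg (sub_nonneg.2 (h τ (le_of_lt hτ))) (sub_nonneg.2 (le_of_lt hτ))
  linarith

/-! ### Derivative of the energy along a trajectory. -/

namespace PDSystem

set_option linter.unusedSectionVars false

variable {X Y : Type*} [NormedAddCommGroup X] [InnerProductSpace ℝ X] [CompleteSpace X]
  [NormedAddCommGroup Y] [InnerProductSpace ℝ Y] [CompleteSpace Y]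

/-- The energy as a function of its time-dependent ingredients. -/
noncomputable def energyFun (S : PDSystem X Y) (a e b r : ℝ) (x w : X) (l : Y) (y : X) (k : Y) :
    ℝ :=
  a * (S.pertLagrangian e x k - S.pertLagrangian e y k)
    + 1 / 2 * ‖(S.α - 1) • (x - y) + r • w‖ ^ 2 + 1 / 2 * b * ‖x - y‖ ^ 2
    + 1 / 2 * ‖l - k‖ ^ 2

/-- The combination `m ẋ + γ ∇ₓL_t` of velocity and gradient along a trajectory. -/
noncomputable def momentum (S : PDSystem X Y) (x : ℝ → X) (l : ℝ → Y) (t : ℝ) : X :=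
  S.m t • timeDeriv S.t₀ x t + S.γ • S.gradX t (x t) (l t)

theorem energy_eq_energyFun (S : PDSystem X Y) (x : ℝ → X) (l : ℝ → Y) (xs : ℝ → X)
    (ls : ℝ → Y) (t : ℝ) :
    S.energy x l xs ls t = S.energyFun (S.coefA t * t ^ S.q) (S.tikh t) (S.coefB t) (t ^ S.q)
      (x t) (S.momentum x l t) (l t) (xs t) (ls t) := by
  rw [energy, regLagrangian_eq_pertLagrangian]
  rfl

/-- Used twice: Lipschitz continuity of the nine arguments passes to the energy, and so does their
differentiability. -/
theorem contDiff_energyFun (S : PDSystem X Y) (hf : ContDiff ℝ 1 S.f) :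
    ContDiff ℝ 1 (fun u : ℝ × ℝ × ℝ × ℝ × X × X × Y × X × Y =>
      S.energyFun u.1 u.2.1 u.2.2.1 u.2.2.2.1 u.2.2.2.2.1 u.2.2.2.2.2.1 u.2.2.2.2.2.2.1
        u.2.2.2.2.2.2.2.1 u.2.2.2.2.2.2.2.2) := by
  have h1 : ContDiff ℝ 1 (fun u : ℝ × X × Y => S.pertLagrangian u.1 u.2.1 u.2.2) := by
    unfold pertLagrangian
    have i1 : ContDiff ℝ 1 (fun u : ℝ × X × Y => S.f u.2.1) := hf.comp (by fun_prop)
    have i2 : ContDiff ℝ 1 (fun u : ℝ × X × Y => ⟪u.2.2, S.A u.2.1 - S.b⟫_ℝ) :=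
      ContDiff.inner ℝ (by fun_prop) (by fun_prop)
    have i3 : ContDiff ℝ 1 (fun u : ℝ × X × Y => ‖u.2.1‖ ^ 2) :=
      ContDiff.norm_sq ℝ (by fun_prop)
    have i4 : ContDiff ℝ 1 (fun u : ℝ × X × Y => ‖u.2.2‖ ^ 2) :=
      ContDiff.norm_sq ℝ (by fun_prop)
    fun_prop
  unfold energyFun
  refine (((ContDiff.mul (by fun_prop) (ContDiff.sub
    (h1.comp (f := fun u : ℝ × ℝ × ℝ × ℝ × X × X × Y × X × Y =>
      (u.2.1, u.2.2.2.2.1, u.2.2.2.2.2.2.2.2)) (by fun_prop))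
    (h1.comp (f := fun u : ℝ × ℝ × ℝ × ℝ × X × X × Y × X × Y =>
      (u.2.1, u.2.2.2.2.2.2.2.1, u.2.2.2.2.2.2.2.2)) (by fun_prop)))).add
      (ContDiff.mul (by fun_prop) (ContDiff.norm_sq ℝ (by fun_prop)))).add
      (ContDiff.mul (by fun_prop) (ContDiff.norm_sq ℝ (by fun_prop)))).add
      (ContDiff.mul (by fun_prop) (ContDiff.norm_sq ℝ (by fun_prop)))

/-- Change of the energy when the saddle point moves. -/
theorem energyFun_le (S : PDSystem X Y) (hα : 1 < S.α) {a e b r v N : ℝ} (ha : 0 ≤ a) (he : 0 ≤ e)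
    (x w : X) (l : Y) (y y' : X) (k k' : Y)
    (hv : v ≤ S.pertLagrangian e y' k') (hy : ‖y' - y‖ ≤ N) (hk : ‖k' - k‖ ≤ N) :
    S.energyFun a e b r x w l y' k' ≤
      (a * (S.pertLagrangian e x k - v)
        + 1 / 2 * ‖(S.α - 1) • (x - y) + r • w‖ ^ 2 + 1 / 2 * b * ‖x - y‖ ^ 2
        + 1 / 2 * ‖l - k‖ ^ 2)
      + N * (a * ‖S.A x - S.b - e • k‖ + (S.α - 1) * ‖(S.α - 1) • (x - y) + r • w‖
          + |b| * ‖x - y‖ + ‖l - k‖ + N * (1 / 2 * (S.α - 1) ^ 2 + 1 / 2 * |b| + 1 / 2)) := by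
  have hα' : 0 ≤ S.α - 1 := by linarith
  have hN : 0 ≤ N := (norm_nonneg _).trans hy
  set z := (S.α - 1) • (x - y) + r • w with hz
  set d := y' - y with hd
  set h := k' - k with hh
  have e1 : (S.α - 1) • (x - y') + r • w = z - (S.α - 1) • d := by rw [hz, hd]; module
  have e2 : x - y' = (x - y) - d := by rw [hd]; abel
  have e3 : l - k' = (l - k) - h := by rw [hh]; abel
  have e4 : S.pertLagrangian e x k' = S.pertLagrangian e x k + ⟪h, S.A x - S.b - e • k⟫_ℝ
      - e / 2 * ‖h‖ ^ 2 := by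
    have : k' = k + h := by rw [hh]; abel
    rw [this]
    simp only [pertLagrangian, inner_add_left, inner_sub_right, inner_smul_right, norm_add_sq_real,
      real_inner_comm k h]
    ring
  have i1 : ⟪h, S.A x - S.b - e • k⟫_ℝ ≤ N * ‖S.A x - S.b - e • k‖ :=
    (real_inner_le_norm _ _).trans (mul_le_mul_of_nonneg_right hk (norm_nonneg _))
  have i2 : -⟪z, d⟫_ℝ ≤ N * ‖z‖ := by
    rw [← inner_neg_right, mul_comm]
    refine (real_inner_le_norm _ _).trans (mul_le_mul_of_nonneg_left ?_ (norm_nonneg _))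
    rwa [norm_neg]
  have i3 : -(b * ⟪x - y, d⟫_ℝ) ≤ N * (|b| * ‖x - y‖) := by
    calc -(b * ⟪x - y, d⟫_ℝ) ≤ |b * ⟪x - y, d⟫_ℝ| := neg_le_abs _
      _ = |b| * |⟪x - y, d⟫_ℝ| := abs_mul _ _
      _ ≤ |b| * (‖x - y‖ * ‖d‖) :=
        mul_le_mul_of_nonneg_left (abs_real_inner_le_norm _ _) (abs_nonneg _)
      _ ≤ |b| * (‖x - y‖ * N) := by gcongr
      _ = _ := by ring
  have i4 : -⟪l - k, h⟫_ℝ ≤ N * ‖l - k‖ := by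
    rw [← inner_neg_right, mul_comm]
    refine (real_inner_le_norm _ _).trans (mul_le_mul_of_nonneg_left ?_ (norm_nonneg _))
    rwa [norm_neg]
  have j1 : ‖d‖ ^ 2 ≤ N ^ 2 := pow_le_pow_left₀ (norm_nonneg _) hy 2
  have j2 : ‖h‖ ^ 2 ≤ N ^ 2 := pow_le_pow_left₀ (norm_nonneg _) hk 2
  have j3 : b * ‖d‖ ^ 2 ≤ |b| * N ^ 2 :=
    mul_le_mul (le_abs_self b) j1 (by positivity) (abs_nonneg _)
  -- The Lagrangian is concave in the multiplier, so its second-order term is nonpositive and can be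
  -- dropped.
  have j4 : a * (⟪h, S.A x - S.b - e • k⟫_ℝ - e / 2 * ‖h‖ ^ 2)
      ≤ a * (N * ‖S.A x - S.b - e • k‖) :=
    mul_le_mul_of_nonneg_left (by nlinarith [mul_nonneg he (sq_nonneg ‖h‖)]) ha
  have j5 := mul_le_mul_of_nonneg_left hv ha
  have j6 := mul_le_mul_of_nonneg_left i2 hα'
  have j7 := mul_le_mul_of_nonneg_left j1 (sq_nonneg (S.α - 1))
  rw [energyFun, e1, e2, e3, e4, norm_sub_sq_real z, norm_sub_sq_real (x - y),
    norm_sub_sq_real (l - k), norm_smul, inner_smul_right, mul_pow, Real.norm_eq_abs, sq_abs]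
  linarith

theorem hasDerivAt_tikh (S : PDSystem X Y) {t : ℝ} (ht : 0 < t) :
    HasDerivAt S.tikh (-(S.p / t * S.tikh t)) t := by
  have h := (Real.hasDerivAt_rpow_const (p := -S.p) (Or.inl ht.ne')).const_mul S.c
  refine (h.congr_of_eventuallyEq ?_).congr_deriv ?_
  · filter_upwards [lt_mem_nhds ht] with τ hτ using S.tikh_eq hτ
  · rw [S.tikh_eq ht, Real.rpow_sub_one ht.ne']
    ring

section Solution

variable {S : PDSystem X Y} {x : ℝ → X} {l : ℝ → Y}

/-- The primal equation eliminates ẍ and the derivative of the gradient together. -/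
theorem hasDerivAt_momentum (hsol : S.IsGlobalSolution x l)
    (hm_diff : ∀ t, S.t₀ ≤ t → TimeDiffAt S.t₀ S.m t) {t : ℝ} (ht : S.t₀ < t) :
    HasDerivAt (S.momentum x l)
      ((S.mdot t - S.α / t ^ S.q) • timeDeriv S.t₀ x t - t ^ S.s • S.gradX t (x t) (l t)) t := by
  have h1 := ((hm_diff t ht.le).hasDerivAt ht).smul ((hsol.diff_xdot t ht.le).hasDerivAt ht)
  have h2 := ((hsol.diff_grad t ht.le).hasDerivAt ht).const_smul S.γ
  refine (h1.add h2).congr_deriv ?_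
  have h3 := hsol.primal t ht.le
  rw [mdot, sub_smul, sub_sub, eq_sub_iff_add_eq, ← sub_eq_zero, ← h3]
  abel

theorem hasDerivAt_dual (hsol : S.IsGlobalSolution x l) {t : ℝ} (ht : S.t₀ < t)
    (hD : S.dualScale t ≠ 0) :
    HasDerivAt l (((S.α - 1) * S.dualScale t) •
      (S.A (x t + S.theta t • timeDeriv S.t₀ x t) - S.b - S.tikh t • l t)) t := by
  refine ((hsol.diff_l t ht.le).hasDerivAt ht).congr_deriv ?_
  rw [← S.gradL_eq]
  exact sub_eq_zero.1 (hsol.dual t ht.le hD)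

theorem dualScale_eq (S : PDSystem X Y) {t : ℝ} (ht : 0 < t) :
    S.dualScale t = t ^ S.q * t ^ S.s - S.γ * (S.q * t ^ (S.q - 1)) := by
  rw [dualScale, Real.rpow_add ht]
  ring

/-- The form a = mD - γβ in which the cross terms of the energy derivative are seen to cancel. -/
theorem coefA_eq (S : PDSystem X Y) {t : ℝ} (ht : 0 < t) :
    S.coefA t = S.m t * S.dualScale t
      - S.γ * (S.q * S.m t * t ^ (S.q - 1) + S.mdot t * t ^ S.q - 1) := by
  rw [coefA, S.dualScale_eq ht, Real.rpow_add ht]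
  ring

/-- The extrapolation is tuned so that the dual equation produces A ẋ with exactly the weight that
the gap has in the energy. -/
theorem theta_mul (S : PDSystem X Y) {t : ℝ} (ht : 0 < t) (hα : 1 < S.α)
    (hD : S.dualScale t ≠ 0) :
    (S.α - 1) * S.dualScale t * S.theta t = S.coefA t * t ^ S.q := by
  have : S.α - 1 ≠ 0 := by linarith
  rw [theta, mul_div_cancel₀ _ (mul_ne_zero this hD), coefA, Real.rpow_add ht, Real.rpow_add ht,
    Real.rpow_sub_one ht.ne', Real.rpow_sub_one ht.ne', two_mul, Real.rpow_add ht]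
  ring

/-- The cancellations in the derivative of the energy along a trajectory. -/
theorem inner_cancellation (A : X →L[ℝ] Y) (α β γ D e a m r : ℝ) (ha : a = m * D - γ * β)
    (v d g G : X) (n : Y) (hG : G = g + A.adjoint n) :
    a * r * ⟪g, v⟫_ℝ + ⟪(α - 1) • d + r • (m • v + γ • G), β • v - D • G⟫_ℝ
        - (α - 1) * β * ⟪d, v⟫_ℝ + ⟪n, ((α - 1) * D) • (A d - e • n) + (a * r) • A v⟫_ℝ
      = -((α - 1) * D * ⟪d, g⟫_ℝ) + r * m * β * ‖v‖ ^ 2 - γ * D * r * ‖G‖ ^ 2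
        - (α - 1) * D * e * ‖n‖ ^ 2 := by
  have h1 : ⟪G, v⟫_ℝ = ⟪g, v⟫_ℝ + ⟪n, A v⟫_ℝ := by
    rw [hG, inner_add_left, ContinuousLinearMap.adjoint_inner_left]
  have h2 : ⟪d, G⟫_ℝ = ⟪d, g⟫_ℝ + ⟪n, A d⟫_ℝ := by
    rw [hG, inner_add_right, ContinuousLinearMap.adjoint_inner_right, real_inner_comm n]
  simp only [inner_add_left, inner_add_right, inner_sub_right, inner_smul_left,
    inner_smul_right, conj_trivial, real_inner_self_eq_norm_sq, real_inner_comm G v, h1, h2]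
  -- The squared norm contributes -r(mD - γβ)⟪G, v⟫ and the gap and dual terms contribute ar⟪G, v⟫,
  -- so this value of a removes ⟪G, v⟫.
  rw [ha]
  ring

end Solution

/-- Upper bound of the derivative of the energy by the formal derivative with frozen saddle
point plus the contribution of the motion of the saddle point. -/
theorem deriv_energy_le_formal (S : PDSystem X Y) (hf : ContDiff ℝ 1 S.f)
    (ht₀ : 0 < S.t₀) (hα : 1 < S.α) (hc : 0 < S.c) {x : ℝ → X} {l : ℝ → Y} {xs : ℝ → X} {ls : ℝ → Y}
    (hsaddle : ∀ t, S.t₀ ≤ t → IsSaddlePoint (S.regLagrangian t) (xs t) (ls t))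
    {R t A' B' E' : ℝ} {x' w' : X} {l' : Y} (ht : S.t₀ < t)
    (hR : ∀ τ, t ≤ τ → ‖xs τ - xs t‖ ≤ R / t * (τ - t) ∧ ‖ls τ - ls t‖ ≤ R / t * (τ - t))
    (hxs : ContinuousAt xs t)
    (ha : ∀ τ, t ≤ τ → 0 ≤ S.coefA τ)
    (hA : HasDerivAt (fun τ => S.coefA τ * τ ^ S.q) A' t) (hB : HasDerivAt S.coefB B' t)
    (hx : HasDerivAt x x' t) (hw : HasDerivAt (S.momentum x l) w' t) (hl : HasDerivAt l l' t)
    (hE : HasDerivAt (S.energy x l xs ls) E' t) :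
    E' ≤ A' * (S.pertLagrangian (S.tikh t) (x t) (ls t) - S.pertLagrangian (S.tikh t) (xs t) (ls t))
      + S.coefA t * t ^ S.q * (⟪gradient S.f (x t) + S.A.adjoint (ls t) + S.tikh t • x t, x'⟫_ℝ
          + S.p / t * S.tikh t / 2 * (‖xs t‖ ^ 2 - ‖x t‖ ^ 2))
      + ⟪(S.α - 1) • (x t - xs t) + t ^ S.q • S.momentum x l t,
          (S.α - 1) • x' + ((S.q * t ^ (S.q - 1)) • S.momentum x l t + t ^ S.q • w')⟫_ℝ
      + 1 / 2 * B' * ‖x t - xs t‖ ^ 2 + S.coefB t * ⟪x t - xs t, x'⟫_ℝ + ⟪l t - ls t, l'⟫_ℝ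
      + R / t * (S.coefA t * t ^ S.q * ‖S.A (x t) - S.b - S.tikh t • ls t‖
          + (S.α - 1) * ‖(S.α - 1) • (x t - xs t) + t ^ S.q • S.momentum x l t‖
          + |S.coefB t| * ‖x t - xs t‖ + ‖l t - ls t‖) := by
  have ht0 : 0 < t := ht₀.trans ht
  simp only [regLagrangian_eq_pertLagrangian] at hsaddle
  have hq : HasDerivAt (fun τ : ℝ => τ ^ S.q) (S.q * t ^ (S.q - 1)) t :=
    Real.hasDerivAt_rpow_const (Or.inl ht0.ne')
  have he := S.hasDerivAt_tikh ht0
  have hfx : HasDerivAt (fun τ => S.f (x τ)) ⟪gradient S.f (x t), x'⟫_ℝ t := by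
    have h1 : HasFDerivAt S.f (InnerProductSpace.toDual ℝ X (gradient S.f (x t))) (x t) :=
      (hf.differentiable one_ne_zero (x t)).hasGradientAt.hasFDerivAt
    exact (h1.comp_hasDerivAt t hx).congr_deriv (by simp)
  have hin : HasDerivAt (fun τ => ⟪ls t, S.A (x τ) - S.b⟫_ℝ) ⟪ls t, S.A x'⟫_ℝ t := by
    have h1 : HasDerivAt (fun τ => S.A (x τ) - S.b) (S.A x') t :=
      (S.A.hasFDerivAt.comp_hasDerivAt t hx).sub_const S.b
    simpa using (hasDerivAt_const t (ls t)).inner ℝ h1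
  have hpert : HasDerivAt (fun τ => S.pertLagrangian (S.tikh τ) (x τ) (ls t)) _ t :=
    (hfx.add hin).add ((he.div_const 2).mul (hx.norm_sq.sub_const (‖ls t‖ ^ 2)))
  -- Only continuity of `xs` is available; it suffices because the factor in front vanishes at τ =
  -- t.
  have hv : HasDerivAt (fun τ => (S.tikh τ - S.tikh t) / 2 * (‖xs τ‖ ^ 2 - ‖ls t‖ ^ 2)) _ t :=
    ((he.sub_const (S.tikh t)).div_const 2).mul_continuousAt (by simp)
      ((hxs.norm.pow 2).sub continuousAt_const)
  have hgap := hA.mul (hpert.sub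
    (hv.const_add (S.pertLagrangian (S.tikh t) (xs t) (ls t))))
  have hzd : HasDerivAt (fun τ => (S.α - 1) • (x τ - xs t) + τ ^ S.q • S.momentum x l τ) _ t :=
    ((hx.sub_const (xs t)).const_smul (S.α - 1)).add (hq.smul hw)
  -- The norms here may fail to be differentiable at zeros. They are multiplied by (R/t)(τ - t), so
  -- continuity at t is enough.
  have hΨc : ContinuousAt (fun τ => S.coefA τ * τ ^ S.q * ‖S.A (x τ) - S.b - S.tikh τ • ls t‖
      + (S.α - 1) * ‖(S.α - 1) • (x τ - xs t) + τ ^ S.q • S.momentum x l τ‖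
      + |S.coefB τ| * ‖x τ - xs t‖ + ‖l τ - ls t‖
      + R / t * (τ - t) * (1 / 2 * (S.α - 1) ^ 2 + 1 / 2 * |S.coefB τ| + 1 / 2)) t := by
    have c1 := hA.continuousAt
    have c2 := hB.continuousAt
    have c3 := hx.continuousAt
    have c4 := hzd.continuousAt
    have c5 := hl.continuousAt
    have c6 := he.continuousAt
    have c7 : ContinuousAt (fun τ => S.A (x τ)) t := S.A.continuous.continuousAt.comp c3
    fun_prop
  have hΨ := (((hasDerivAt_id t).sub_const t).const_mul (R / t)).mul_continuousAt
    (by simp) hΨc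
  have hk := (((hgap.add (hzd.norm_sq.const_mul (1 / 2))).add
    ((hB.const_mul (1 / 2)).mul (hx.sub_const (xs t)).norm_sq)).add
    ((hl.sub_const (ls t)).norm_sq.const_mul (1 / 2))).add hΨ
  -- The majorant agrees with the energy at t and dominates it for τ ≥ t.
  have key := hE.le_of_le_right hk ?_ ?_
  · refine key.trans (le_of_eq ?_)
    simp only [inner_add_left, inner_add_right, inner_smul_left, inner_smul_right,
      ContinuousLinearMap.adjoint_inner_left, conj_trivial, sub_self, mul_zero,
      Pi.sub_apply]
    ring
  · rw [energy_eq_energyFun, energyFun]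
    simp
  · intro τ hτ
    rw [energy_eq_energyFun]
    have hτ0 := ht0.trans_le hτ
    have hsv := S.saddle_value_ge (hsaddle t ht.le) (hsaddle τ (ht.le.trans hτ))
    have := S.energyFun_le hα (b := S.coefB τ) (r := τ ^ S.q)
      (mul_nonneg (ha τ hτ) (Real.rpow_nonneg hτ0.le S.q))
      (S.tikh_pos hc hτ0).le (x τ) (S.momentum x l τ) (l τ) (xs t) (xs τ) (ls t) (ls τ)
      hsv (hR τ hτ).1 (hR τ hτ).2
    refine this.trans (le_of_eq ?_)
    simp

/-- The energy and its derivative are controlled by the distances to the saddle point, the norms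
of velocity and gradient, and the gap of the Lagrangian. -/
theorem exists_scalar_bounds (S : PDSystem X Y) (hfc : ConvexOn ℝ univ S.f)
    (hf : ContDiff ℝ 1 S.f) (ht₀ : 0 < S.t₀) (hα : 1 < S.α) (hγ : 0 < S.γ) (hc : 0 < S.c)
    (hp₀ : 0 < S.p) (hm_pos : ∀ t, S.t₀ ≤ t → 0 < S.m t)
    (hm_diff : ∀ t, S.t₀ ≤ t → TimeDiffAt S.t₀ S.m t)
    {x : ℝ → X} {l : ℝ → Y} (hsol : S.IsGlobalSolution x l) {xs : ℝ → X} {ls : ℝ → Y}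
    (hsaddle : ∀ t, S.t₀ ≤ t → IsSaddlePoint (S.regLagrangian t) (xs t) (ls t))
    {R t A' B' E' : ℝ} (ht : S.t₀ < t) (hR0 : 0 ≤ R) (hRb : ‖xs t‖ ≤ R)
    (hR : ∀ τ, t ≤ τ → ‖xs τ - xs t‖ ≤ R / t * (τ - t) ∧ ‖ls τ - ls t‖ ≤ R / t * (τ - t))
    (hxs : ContinuousAt xs t) (hD : 0 < S.dualScale t)
    (ha : ∀ τ, t ≤ τ → 0 ≤ S.coefA τ)
    (hA : HasDerivAt (fun τ => S.coefA τ * τ ^ S.q) A' t) (hB : HasDerivAt S.coefB B' t)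
    (hE : HasDerivAt (S.energy x l xs ls) E' t) :
    ∃ d v g n Δ : ℝ, S.tikh t / 2 * d ^ 2 ≤ Δ ∧
      S.energy x l xs ls t ≤ S.coefA t * t ^ S.q * Δ
        + (S.α - 1) ^ 2 * d ^ 2 + 2 * (t ^ S.q) ^ 2 * (S.m t ^ 2 * v ^ 2 + S.γ ^ 2 * g ^ 2)
        + 1 / 2 * |S.coefB t| * d ^ 2 + 1 / 2 * n ^ 2 ∧
      E' ≤ A' * Δ - (S.α - 1) * S.dualScale t * (Δ + S.tikh t / 2 * d ^ 2)
        + S.coefA t * t ^ S.q * (S.p / t * S.tikh t) * R * d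
        + t ^ S.q * S.m t * (S.q * S.m t * t ^ (S.q - 1) + S.mdot t * t ^ S.q - 1) * v ^ 2
        - S.γ * S.dualScale t * t ^ S.q * g ^ 2 + 1 / 2 * B' * d ^ 2
        - (S.α - 1) * S.dualScale t * S.tikh t * n ^ 2
        + R / t * (S.coefA t * t ^ S.q * (‖S.A‖ * d)
          + (S.α - 1) * ((S.α - 1) * d + t ^ S.q * (S.m t * v + S.γ * g))
          + |S.coefB t| * d + n) := by
  have ht0 : 0 < t := ht₀.trans ht
  have hr : 0 < t ^ S.q := Real.rpow_pos_of_pos ht0 _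
  have hx := (hsol.diff_x t ht.le).hasDerivAt ht
  have hw := hasDerivAt_momentum hsol hm_diff ht
  have hl := hasDerivAt_dual hsol ht hD.ne'
  have hE' := S.deriv_energy_le_formal hf ht₀ hα hc hsaddle ht hR hxs ha hA hB hx hw hl hE
  have hsp := hsaddle t ht.le
  rw [regLagrangian_eq_pertLagrangian] at hsp
  have hm := hm_pos t ht.le
  have he := S.tikh_pos hc ht0
  have haA : 0 ≤ S.coefA t * t ^ S.q := mul_nonneg (ha t le_rfl) hr.le
  have hα' : 0 < S.α - 1 := by linarith
  set V := timeDeriv S.t₀ x t with hV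
  set G := S.gradX t (x t) (l t) with hGdef
  set g := gradient S.f (x t) + S.A.adjoint (ls t) + S.tikh t • x t with hg
  have hw' : S.momentum x l t = S.m t • V + S.γ • G := rfl
  have hG : G = g + S.A.adjoint (l t - ls t) := by
    rw [hGdef, S.gradX_eq hf, hg, map_sub]; abel
  -- Optimality in the multiplier gives A x_t - b = ε λ_t.
  have hAx : S.A (x t) - S.b - S.tikh t • ls t = S.A (x t - xs t) := by
    have := S.kkt_right hsp
    rw [map_sub, sub_eq_sub_iff_add_eq_add, ← sub_eq_zero, ← this]
    abel_nf
  have hl' : ((S.α - 1) * S.dualScale t) •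
      (S.A (x t + S.theta t • V) - S.b - S.tikh t • l t)
      = ((S.α - 1) * S.dualScale t) • (S.A (x t - xs t) - S.tikh t • (l t - ls t))
        + (S.coefA t * t ^ S.q) • S.A V := by
    rw [← S.theta_mul ht0 hα hD.ne', ← hAx, map_add, map_smul]
    module
  -- The damping contributes -αẋ after multiplication by t^q, so the coefficients of ẋ collect to β
  -- and those of the gradient to -D.
  have hz' : (S.α - 1) • V + ((S.q * t ^ (S.q - 1)) • S.momentum x l t
      + t ^ S.q • ((S.mdot t - S.α / t ^ S.q) • V - t ^ S.s • G))
      = (S.q * S.m t * t ^ (S.q - 1) + S.mdot t * t ^ S.q - 1) • V - S.dualScale t • G := by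
    rw [hw', S.dualScale_eq ht0]
    have : t ^ S.q * (S.α / t ^ S.q) = S.α := by field_simp
    simp only [smul_sub, smul_add, smul_smul, sub_smul, this]
    module
  have hcan := inner_cancellation S.A S.α
    (S.q * S.m t * t ^ (S.q - 1) + S.mdot t * t ^ S.q - 1) S.γ (S.dualScale t) (S.tikh t)
    (S.coefA t) (S.m t) (t ^ S.q) (S.coefA_eq ht0) V (x t - xs t) g G (l t - ls t) hG
  have hB' : S.coefB t
      = -((S.α - 1) * (S.q * S.m t * t ^ (S.q - 1) + S.mdot t * t ^ S.q - 1)) := by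
    rw [coefB]; ring
  rw [hl', hz', hw', hAx] at hE'
  have hin := S.inner_gradient_ge hfc hf (S.tikh t) (x t) (xs t) (ls t)
  have hz : ‖(S.α - 1) • (x t - xs t) + t ^ S.q • (S.m t • V + S.γ • G)‖
      ≤ (S.α - 1) * ‖x t - xs t‖ + t ^ S.q * (S.m t * ‖V‖ + S.γ * ‖G‖) := by
    refine (norm_add_le _ _).trans ?_
    rw [norm_smul, norm_smul, Real.norm_of_nonneg hα'.le, Real.norm_of_nonneg hr.le]
    gcongr
    refine (norm_add_le _ _).trans ?_
    rw [norm_smul, norm_smul, Real.norm_of_nonneg hm.le, Real.norm_of_nonneg hγ.le]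
  -- Factor the difference of squares; when it is positive, both norms are at most R.
  have hnorm : ‖xs t‖ ^ 2 - ‖x t‖ ^ 2 ≤ 2 * R * ‖x t - xs t‖ := by
    have h1 := norm_sub_norm_le (xs t) (x t)
    rw [norm_sub_rev] at h1
    have h2 := norm_nonneg (x t)
    have h3 := norm_nonneg (x t - xs t)
    rcases le_total ‖xs t‖ ‖x t‖ with h4 | h4
    · have := pow_le_pow_left₀ (norm_nonneg (xs t)) h4 2
      have := mul_nonneg hR0 h3
      linarith
    · have h5 := mul_le_mul h1 (add_le_add hRb (h4.trans hRb)) (by positivity) h3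
      linarith
  have hAop := S.A.le_opNorm (x t - xs t)
  refine ⟨‖x t - xs t‖, ‖V‖, ‖G‖, ‖l t - ls t‖, _, S.saddle_gap_ge hfc hf hsp (x t), ?_, ?_⟩
  · rw [energy_eq_energyFun, energyFun, hw']
    have h1 := pow_le_pow_left₀ (norm_nonneg _) hz 2
    have h2 : 1 / 2 * S.coefB t * ‖x t - xs t‖ ^ 2 ≤ 1 / 2 * |S.coefB t| * ‖x t - xs t‖ ^ 2 := by
      gcongr; exact le_abs_self _
    have h3 := sq_nonneg ((S.α - 1) * ‖x t - xs t‖ - t ^ S.q * (S.m t * ‖V‖ + S.γ * ‖G‖))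
    have h4 := sq_nonneg (t ^ S.q * (S.m t * ‖V‖ - S.γ * ‖G‖))
    -- Once the nonlinear blocks are atoms, the remaining inequality is linear.
    generalize ‖(S.α - 1) • (x t - xs t) + t ^ S.q • (S.m t • V + S.γ • G)‖ ^ 2 = Z at *
    generalize S.coefA t * t ^ S.q *
      (S.pertLagrangian (S.tikh t) (x t) (ls t) - S.pertLagrangian (S.tikh t) (xs t) (ls t)) = P
    generalize 1 / 2 * S.coefB t * ‖x t - xs t‖ ^ 2 = Q₁ at *
    generalize 1 / 2 * |S.coefB t| * ‖x t - xs t‖ ^ 2 = Q₂ at *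
    linarith
  · refine hE'.trans ?_
    have h1 : R / t * (S.coefA t * t ^ S.q * ‖S.A (x t - xs t)‖
          + (S.α - 1) * ‖(S.α - 1) • (x t - xs t) + t ^ S.q • (S.m t • V + S.γ • G)‖
          + |S.coefB t| * ‖x t - xs t‖ + ‖l t - ls t‖)
        ≤ R / t * (S.coefA t * t ^ S.q * (‖S.A‖ * ‖x t - xs t‖)
          + (S.α - 1) * ((S.α - 1) * ‖x t - xs t‖ + t ^ S.q * (S.m t * ‖V‖ + S.γ * ‖G‖))
          + |S.coefB t| * ‖x t - xs t‖ + ‖l t - ls t‖) := by gcongr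
    have h2 := mul_le_mul_of_nonneg_left hin (mul_nonneg hα'.le hD.le)
    have h3 := mul_le_mul_of_nonneg_left hnorm (mul_nonneg haA
      (mul_nonneg (div_pos hp₀ ht0).le he.le))
    have h4 : S.coefB t * ⟪x t - xs t, V⟫_ℝ
        = -((S.α - 1) * (S.q * S.m t * t ^ (S.q - 1) + S.mdot t * t ^ S.q - 1)
          * ⟪x t - xs t, V⟫_ℝ) := by
      rw [hB']; ring
    rw [← hg] at h2
    rw [mul_add (S.coefA t * t ^ S.q), h4]
    generalize R / t * (S.coefA t * t ^ S.q * ‖S.A (x t - xs t)‖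
          + (S.α - 1) * ‖(S.α - 1) • (x t - xs t) + t ^ S.q • (S.m t • V + S.γ • G)‖
          + |S.coefB t| * ‖x t - xs t‖ + ‖l t - ls t‖) = Z₁ at *
    generalize R / t * (S.coefA t * t ^ S.q * (‖S.A‖ * ‖x t - xs t‖)
          + (S.α - 1) * ((S.α - 1) * ‖x t - xs t‖ + t ^ S.q * (S.m t * ‖V‖ + S.γ * ‖G‖))
          + |S.coefB t| * ‖x t - xs t‖ + ‖l t - ls t‖) = Z₂ at *
    generalize ⟪(S.α - 1) • (x t - xs t) + t ^ S.q • (S.m t • V + S.γ • G),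
            (S.q * S.m t * t ^ (S.q - 1) + S.mdot t * t ^ S.q - 1) • V - S.dualScale t • G⟫_ℝ
      = I₁ at *
    generalize ⟪l t - ls t,
        ((S.α - 1) * S.dualScale t) • (S.A (x t - xs t) - S.tikh t • (l t - ls t))
          + (S.coefA t * t ^ S.q) • S.A V⟫_ℝ = I₂ at *
    generalize (S.α - 1) * (S.q * S.m t * t ^ (S.q - 1) + S.mdot t * t ^ S.q - 1)
          * ⟪x t - xs t, V⟫_ℝ = I₃ at *
    generalize S.coefA t * t ^ S.q * ⟪g, V⟫_ℝ = I₄ at *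
    clear_value V G g
    clear hw hx hl hl' hz' hB' hG hAx hE
    linarith

end PDSystem

/-! ### Scalar inequalities at a fixed large time. -/

theorem young_le {k b E y : ℝ} (hk : 0 < k) (h : b ^ 2 ≤ 4 * k * E) : b * y - k * y ^ 2 ≤ E := by
  have h1 : 0 ≤ 4 * k * (E + k * y ^ 2 - b * y) := by nlinarith [sq_nonneg (2 * k * y - b)]
  have := nonneg_of_mul_nonneg_right h1 (by positivity : 0 < 4 * k)
  linarith

/-- The bounds at a fixed large time under which the energy estimate holds, for the values
`r, σ, π` of the powers `t ^ q, t ^ s, t ^ p`, the mass `m` and its derivatives `m', m''`. -/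
structure LargeTime (α q γ s c k₁ k₂ M t r σ π m m' m'' : ℝ) : Prop where
  ht : 1 ≤ t
  hr : 1 ≤ r
  hσ : 1 ≤ σ
  hπ : 1 ≤ π
  hπt : π ≤ t
  hm : 0 < m
  hlow : γ ≤ m * (r * σ)
  hup : m * r ≤ k₁
  hm' : |m'| ≤ k₂ * m / t
  hm'' : |m''| ≤ k₂ * m / t ^ 2
  -- Thresholds: `small₁` keeps D near rσ, `small₂` keeps β near -1, `small₃` and `small₄` control
  -- the derivatives of b and a t^q, and `small₅`, `small₆`, `small₇` absorb the gap, velocity and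
  -- gradient parts of the energy.
  small₁ : 16 * γ * q ≤ t
  small₂ : 32 * ((q + k₂) * k₁) ≤ t
  small₃ : 32 * ((2 * q * k₂ + q + k₂) * k₁) ≤ c * t
  small₄ : 4 * ((k₂ + 4 * q + s) * k₁ + 2 * γ * q * (k₂ + 1) * k₁ + γ * k₂ * (1 + q) * k₁)
    ≤ (α - 1) * t
  small₅ : 12 * M * k₁ ≤ (α - 1) * r
  small₆ : 8 * M * k₁ ≤ r
  small₇ : 32 * M * γ ≤ 7 * r

namespace LargeTime

variable {α q γ s c p k₁ k₂ M t r σ π m m' m'' : ℝ}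

theorem mr_div_le (h : LargeTime α q γ s c k₁ k₂ M t r σ π m m' m'') :
    m * r / t ≤ k₁ / t :=
  div_le_div_of_nonneg_right h.hup (by linarith [h.ht])

theorem abs_m'_mul_le (hk₂ : 0 ≤ k₂) (h : LargeTime α q γ s c k₁ k₂ M t r σ π m m' m'') :
    |m' * r| ≤ k₂ * k₁ / t := by
  have ht : 0 < t := by linarith [h.ht]
  have hr : 0 < r := by linarith [h.hr]
  rw [abs_mul, abs_of_pos hr]
  calc |m'| * r ≤ k₂ * m / t * r := mul_le_mul_of_nonneg_right h.hm' hr.le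
    _ = k₂ * (m * r) / t := by ring
    _ ≤ k₂ * k₁ / t := by gcongr; exact h.hup

theorem abs_m''_mul_le (hk₂ : 0 ≤ k₂) (h : LargeTime α q γ s c k₁ k₂ M t r σ π m m' m'') :
    |m'' * r| ≤ k₂ * k₁ / t ^ 2 := by
  have ht : 0 < t := by linarith [h.ht]
  have hr : 0 < r := by linarith [h.hr]
  rw [abs_mul, abs_of_pos hr]
  calc |m''| * r ≤ k₂ * m / t ^ 2 * r := mul_le_mul_of_nonneg_right h.hm'' hr.le
    _ = k₂ * (m * r) / t ^ 2 := by ring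
    _ ≤ k₂ * k₁ / t ^ 2 := by gcongr; exact h.hup

/-- Both q m t^(q-1) and ṁ t^q are O(1/t), because m t^q is bounded. -/
theorem beta_bounds (hq : 0 < q) (hk₂ : 0 ≤ k₂)
    (h : LargeTime α q γ s c k₁ k₂ M t r σ π m m' m'') :
    -(33 / 32) ≤ q * m * (r / t) + m' * r - 1 ∧ q * m * (r / t) + m' * r - 1 ≤ -(31 / 32) := by
  have ht : 0 < t := by linarith [h.ht]
  have hr : 0 < r := by linarith [h.hr]
  have hm := h.hm
  have h1 : q * m * (r / t) ≤ q * k₁ / t := by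
    calc q * m * (r / t) = q * (m * r / t) := by ring
      _ ≤ q * (k₁ / t) := mul_le_mul_of_nonneg_left h.mr_div_le hq.le
      _ = q * k₁ / t := by ring
  have h0 : 0 ≤ q * m * (r / t) := by positivity
  have h2 := abs_le.1 (h.abs_m'_mul_le hk₂)
  have h3 : q * k₁ / t + k₂ * k₁ / t ≤ 1 / 32 := by
    rw [← add_div, div_le_iff₀ ht]
    linarith [h.small₂]
  constructor <;> linarith [h2.1, h2.2]

theorem scale_bounds (hq : 0 < q) (hγ : 0 < γ)
    (h : LargeTime α q γ s c k₁ k₂ M t r σ π m m' m'') :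
    15 / 16 * (r * σ) ≤ r * σ - γ * (q * (r / t)) ∧ r * σ - γ * (q * (r / t)) ≤ r * σ := by
  have ht : 0 < t := by linarith [h.ht]
  have hr : 0 < r := by linarith [h.hr]
  have h1 : γ * (q * (r / t)) ≤ 1 / 16 * r := by
    have : γ * q / t ≤ 1 / 16 := by rw [div_le_iff₀ ht]; linarith [h.small₁]
    calc γ * (q * (r / t)) = γ * q / t * r := by ring
      _ ≤ 1 / 16 * r := mul_le_mul_of_nonneg_right this hr.le
  have h2 : r ≤ r * σ := le_mul_of_one_le_right hr.le h.hσ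
  have h3 : 0 ≤ γ * (q * (r / t)) := by positivity
  constructor <;> linarith

/-- The lower mass bound γ ≤ m t^(q+s) absorbs the term -γβ into the main term mD. -/
theorem coef_bounds (hq : 0 < q) (hγ : 0 < γ) (hk₂ : 0 ≤ k₂)
    (h : LargeTime α q γ s c k₁ k₂ M t r σ π m m' m'') :
    0 ≤ m * (r * σ - γ * (q * (r / t))) - γ * (q * m * (r / t) + m' * r - 1) ∧
      m * (r * σ - γ * (q * (r / t))) - γ * (q * m * (r / t) + m' * r - 1)
        ≤ 3 * (m * (r * σ)) := by
  have hr : 0 < r := by linarith [h.hr]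
  have hσ : 0 < σ := by linarith [h.hσ]
  have hb := h.beta_bounds hq hk₂
  have hD := h.scale_bounds hq hγ
  have h1 := mul_le_mul_of_nonneg_left hD.2 h.hm.le
  have h2 := mul_le_mul_of_nonneg_left hD.1 h.hm.le
  have h3 := mul_le_mul_of_nonneg_left hb.1 hγ.le
  have h4 := mul_le_mul_of_nonneg_left hb.2 hγ.le
  have h5 : 0 < m * (r * σ) := mul_pos h.hm (mul_pos hr hσ)
  constructor <;> linarith [h.hlow]

/-- The derivative of b is O(1/t²), and 1/t ≤ t^(q+s-p) because p < 1; it is thus a small part of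
the decay rate εD. -/
theorem coefB_deriv_le (hα : 1 < α) (hq : 0 < q) (hq₁ : q < 1) (hk₂ : 0 ≤ k₂)
    (hc : 0 < c)
    (h : LargeTime α q γ s c k₁ k₂ M t r σ π m m' m'') :
    -(α - 1) * (q * (m' * (r / t) + m * ((q - 1) * (r / t / t)))
        + (m'' * r + m' * (q * (r / t)))) ≤ (α - 1) * (c / 32 * (r * σ / π)) := by
  have ht : 0 < t := by linarith [h.ht]
  have hr : 0 < r := by linarith [h.hr]
  have hm := h.hm
  have h1 := neg_le_of_abs_le (h.abs_m'_mul_le hk₂)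
  have h2 := neg_le_of_abs_le (h.abs_m''_mul_le hk₂)
  have h3 : -(k₂ * k₁ / t ^ 2) ≤ m' * (r / t) := by
    have := div_le_div_of_nonneg_right h1 ht.le
    calc -(k₂ * k₁ / t ^ 2) = -(k₂ * k₁ / t) / t := by field_simp
      _ ≤ m' * r / t := this
      _ = m' * (r / t) := by ring
  have h4 : -(k₁ / t ^ 2) ≤ m * ((q - 1) * (r / t / t)) := by
    have h5 : m * r / t ^ 2 ≤ k₁ / t ^ 2 := div_le_div_of_nonneg_right h.hup (by positivity)
    have h6 : 0 ≤ m * r / t ^ 2 := by positivity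
    have h7 : m * ((q - 1) * (r / t / t)) = (q - 1) * (m * r / t ^ 2) := by field_simp
    rw [h7]
    nlinarith
  have h5 : (2 * q * k₂ + q + k₂) * k₁ / t ^ 2 ≤ c / 32 * (1 / t) := by
    rw [div_le_iff₀ (by positivity)]
    have : c / 32 * (1 / t) * t ^ 2 = c / 32 * t := by field_simp
    rw [this]
    linarith [h.small₃]
  have h6 : 1 / t ≤ r * σ / π := by
    have hπ : 0 < π := by linarith [h.hπ]
    rw [div_le_div_iff₀ ht hπ]
    have : 1 ≤ r * σ := one_le_mul_of_one_le_of_one_le h.hr h.hσ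
    nlinarith [h.hπt]
  have h7 : c / 32 * (1 / t) ≤ c / 32 * (r * σ / π) := by gcongr
  have e : m' * (q * (r / t)) = q * (m' * (r / t)) := by ring
  have h8 := mul_le_mul_of_nonneg_left h3 hq.le
  have h9 := mul_le_mul_of_nonneg_left h4 hq.le
  have hα' : 0 ≤ α - 1 := by linarith
  have h10 : -(q * (m' * (r / t) + m * ((q - 1) * (r / t / t)))
        + (m'' * r + m' * (q * (r / t)))) ≤ c / 32 * (r * σ / π) := by
    rw [e]
    have : (2 * q * k₂ + q + k₂) * k₁ / t ^ 2 = 2 * (q * (k₂ * k₁ / t ^ 2)) + q * (k₁ / t ^ 2)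
      + k₂ * k₁ / t ^ 2 := by ring
    linarith
  calc _ = (α - 1) * -(q * (m' * (r / t) + m * ((q - 1) * (r / t / t)))
        + (m'' * r + m' * (q * (r / t)))) := by ring
    _ ≤ _ := mul_le_mul_of_nonneg_left h10 hα'

/-- Each differentiation costs 1/t and m t^q is bounded, so the derivative of a t^q is O(t^(q+s-1)),
small against the decay (α-1)D of the gap. -/
theorem coefA_deriv_le (hq : 0 < q) (hq₁ : q < 1) (hs : 0 < s) (hγ : 0 < γ)
    (hk₁ : 0 ≤ k₁) (hk₂ : 0 ≤ k₂)
    (h : LargeTime α q γ s c k₁ k₂ M t r σ π m m' m'') :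
    (m' * (r * σ) + m * ((q + s) * (r * σ / t))
        - 2 * γ * q * (m' * (r / t) + m * ((q - 1) * (r / t / t)))
        - γ * (m'' * r + m' * (q * (r / t)))) * r
      + (m * (r * σ - γ * (q * (r / t))) - γ * (q * m * (r / t) + m' * r - 1)) * (q * (r / t))
      ≤ (α - 1) / 4 * (r * σ) := by
  have ht : 0 < t := by linarith [h.ht]
  have hr : 0 < r := by linarith [h.hr]
  have hσ : 0 < σ := by linarith [h.hσ]
  have hm := h.hm
  have ha := (h.coef_bounds hq hγ hk₂).2
  have b1 := abs_le.1 (h.abs_m'_mul_le hk₂)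
  have b2 := abs_le.1 (h.abs_m''_mul_le hk₂)
  have hup := h.hup
  have htt : r / t ≤ r * σ / t :=
    div_le_div_of_nonneg_right (le_mul_of_one_le_right hr.le h.hσ) ht.le
  have htt' : r / t ^ 2 ≤ r * σ / t := by
    refine le_trans ?_ htt
    exact div_le_div_of_nonneg_left hr.le ht (by nlinarith [h.ht])
  set w := r * σ / t with hw
  have hw0 : 0 < w := by positivity
  have hrt0 : 0 < r / t := by positivity
  have t1 : m' * (r * σ) * r ≤ k₂ * k₁ * w := by
    calc m' * (r * σ) * r = m' * r * (r * σ) := by ring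
      _ ≤ k₂ * k₁ / t * (r * σ) := mul_le_mul_of_nonneg_right b1.2 (by positivity)
      _ = k₂ * k₁ * w := by rw [hw]; ring
  have t2 : m * ((q + s) * w) * r ≤ (q + s) * k₁ * w := by
    calc m * ((q + s) * w) * r = (q + s) * (m * r) * w := by ring
      _ ≤ (q + s) * k₁ * w := by gcongr
  have t3 : -(m' * (r / t) * r) ≤ k₂ * k₁ * w := by
    calc -(m' * (r / t) * r) = -(m' * r) * (r / t) := by ring
      _ ≤ k₂ * k₁ / t * (r / t) := mul_le_mul_of_nonneg_right (by linarith [b1.1]) hrt0.le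
      _ = k₂ * k₁ * (r / t ^ 2) := by field_simp
      _ ≤ k₂ * k₁ * w := by gcongr
  have t4 : -(m * ((q - 1) * (r / t / t)) * r) ≤ k₁ * w := by
    calc -(m * ((q - 1) * (r / t / t)) * r) = (1 - q) * (m * r) * (r / t ^ 2) := by
          field_simp; ring
      _ ≤ 1 * k₁ * w := by gcongr; linarith
      _ = k₁ * w := by ring
  have t5 : -(m'' * r * r) ≤ k₂ * k₁ * w := by
    calc -(m'' * r * r) = -(m'' * r) * r := by ring
      _ ≤ k₂ * k₁ / t ^ 2 * r := mul_le_mul_of_nonneg_right (by linarith [b2.1]) hr.le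
      _ = k₂ * k₁ * (r / t ^ 2) := by ring
      _ ≤ k₂ * k₁ * w := by gcongr
  have t6 : (m * (r * σ - γ * (q * (r / t))) - γ * (q * m * (r / t) + m' * r - 1))
      * (q * (r / t)) ≤ 3 * q * k₁ * w := by
    calc _ ≤ 3 * (m * (r * σ)) * (q * (r / t)) := mul_le_mul_of_nonneg_right ha (by positivity)
      _ = 3 * q * (m * r) * w := by rw [hw]; ring
      _ ≤ 3 * q * k₁ * w := by gcongr
  have t7 : ((k₂ + 4 * q + s) * k₁ + 2 * γ * q * (k₂ + 1) * k₁ + γ * k₂ * (1 + q) * k₁) * w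
      ≤ (α - 1) / 4 * (r * σ) := by
    calc _ = ((k₂ + 4 * q + s) * k₁ + 2 * γ * q * (k₂ + 1) * k₁ + γ * k₂ * (1 + q) * k₁) / t
          * (r * σ) := by rw [hw]; ring
      _ ≤ (α - 1) / 4 * (r * σ) := by
        refine mul_le_mul_of_nonneg_right ?_ (by positivity)
        rw [div_le_iff₀ ht]
        linarith [h.small₄]
  refine le_trans ?_ t7
  have u3 := mul_le_mul_of_nonneg_left t3 (by positivity : 0 ≤ 2 * γ * q + γ * q)
  have u4 := mul_le_mul_of_nonneg_left t4 (by positivity : 0 ≤ 2 * γ * q)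
  have u5 := mul_le_mul_of_nonneg_left t5 hγ.le
  generalize m * (r * σ - γ * (q * (r / t))) - γ * (q * m * (r / t) + m' * r - 1) = a at *
  linarith

/-- The constant in the energy estimate, in terms of `κ = c (α - 1) / 16`, of a bound `R` for the
saddle points and of the norm `a` of the constraint operator. -/
noncomputable def errorConst (α γ c p k₁ R a : ℝ) : ℝ :=
  (3 * p * c * R + 3 * R * a + R * ((α - 1) ^ 2 + 2 * (α - 1)) / γ) ^ 2 * k₁
      / (4 * (c * (α - 1) / 16))
    + R ^ 2 * (α - 1) ^ 2 + R ^ 2 / (4 * (c * (α - 1) / 16) * γ)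

/-- The decay terms absorb the derivatives of the coefficients and μ times the energy, and still
keep a fixed fraction of each square for Young's inequality. -/
theorem coef_estimates (hα : 1 < α) (hγ : 0 < γ) (hc : 0 < c) (hM : 0 < M)
    (hM₁ : M * (2 * α - 1) < 3 * c / 4) (hM₂ : M < c * (α - 1))
    (h : LargeTime α q γ s c k₁ k₂ M t r σ π m m' m'')
    {μ Δ β D a A' B' : ℝ} (hμ₁ : μ ≤ M / r)
    (hμ₂ : μ ≤ M * (r * σ / π)) (hΔ0 : 0 ≤ Δ)
    (hb : β ≤ -(31 / 32)) (habs : |-(α - 1) * β| ≤ (α - 1) * (33 / 32))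
    (hDb : 15 / 16 * (r * σ) ≤ D) (hab : 0 ≤ a ∧ a ≤ 3 * (m * (r * σ)))
    (hA' : A' ≤ (α - 1) / 4 * (r * σ))
    (hB' : B' ≤ (α - 1) * (c / 32 * (r * σ / π))) :
    A' * Δ - (α - 1) * D * Δ + μ * (a * r * Δ) ≤ 0 ∧
      -((α - 1) * D * (c / π / 2)) + 1 / 2 * B'
        + μ * ((α - 1) ^ 2 + 1 / 2 * |-(α - 1) * β|) ≤ -(c * (α - 1) / 16 * (r * σ / π)) ∧
      r * m * β + μ * (2 * r ^ 2 * m ^ 2) ≤ -(1 / 4 * (r * m)) ∧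
      -(γ * D * r) + μ * (2 * r ^ 2 * γ ^ 2) ≤ -(γ / 2 * (r * (r * σ))) ∧
      -((α - 1) * D * (c / π)) + μ * (1 / 2) ≤ -(c * (α - 1) / 16 * (r * σ / π)) := by
  have ht : 0 < t := by linarith [h.ht]
  have hr : 0 < r := by linarith [h.hr]
  have hσ : 0 < σ := by linarith [h.hσ]
  have hπ : 0 < π := by linarith [h.hπ]
  have hm := h.hm
  have hα' : 0 < α - 1 := by linarith
  set u := r * σ / π with hu
  have hu0 : 0 < u := by positivity
  have hMc : M < c := by
    have := le_mul_of_one_le_right hM.le (by linarith : 1 ≤ 2 * α - 1)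
    linarith
  have hDu : 15 / 16 * (c * u) ≤ D * (c / π) := by
    calc 15 / 16 * (c * u) = 15 / 16 * (r * σ) * (c / π) := by rw [hu]; ring
      _ ≤ D * (c / π) := mul_le_mul_of_nonneg_right hDb (by positivity)
  refine ⟨?_, ?_, ?_, ?_, ?_⟩
  · have h1 : μ * (a * r) ≤ (α - 1) / 4 * (r * σ) := by
      calc μ * (a * r) ≤ M / r * (3 * (m * (r * σ)) * r) :=
            mul_le_mul hμ₁ (mul_le_mul_of_nonneg_right hab.2 hr.le)
              (mul_nonneg hab.1 hr.le) (by positivity)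
        _ = 3 * M * (m * r) * σ := by field_simp
        _ ≤ 3 * M * k₁ * σ := by gcongr; exact h.hup
        _ ≤ (α - 1) / 4 * r * σ :=
          mul_le_mul_of_nonneg_right (by linarith [h.small₅]) hσ.le
        _ = _ := by ring
    have h2 := mul_le_mul_of_nonneg_left hDb hα'.le
    have h3 : 0 < (α - 1) * (r * σ) := by positivity
    have : (A' - (α - 1) * D + μ * (a * r)) * Δ ≤ 0 :=
      mul_nonpos_of_nonpos_of_nonneg (by linarith) hΔ0
    linarith
  · have h1 := mul_le_mul_of_nonneg_left hDu hα'.le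
    have h2 : μ * ((α - 1) ^ 2 + 1 / 2 * |-(α - 1) * β|)
        ≤ M * u * ((α - 1) ^ 2 + 1 / 2 * ((α - 1) * (33 / 32))) := by gcongr
    -- The left side is M(2α-1)/2 + M/64, which is where the first bound on M enters. The margin
    -- 15/32 - 1/64 - 3/8 - 1/64 = 1/16 is the factor in c(α-1)/16.
    have h3 : M * ((α - 1) + 1 / 2 * (33 / 32)) ≤ 3 * c / 8 + c / 64 := by linarith
    have h4 := mul_le_mul_of_nonneg_left h3 (by positivity : 0 ≤ (α - 1) * u)
    linarith
  · have h1 : μ * (2 * r ^ 2 * m ^ 2) ≤ 1 / 4 * (r * m) := by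
      calc μ * (2 * r ^ 2 * m ^ 2) ≤ M / r * (2 * r ^ 2 * m ^ 2) := by gcongr
        _ = 2 * M * (m * r) * m := by field_simp
        _ ≤ 2 * M * k₁ * m := by gcongr; exact h.hup
        _ ≤ 1 / 4 * r * m := mul_le_mul_of_nonneg_right (by linarith [h.small₆]) hm.le
        _ = _ := by ring
    have h2 := mul_le_mul_of_nonneg_left hb (by positivity : 0 ≤ r * m)
    have h3 : 0 < r * m := by positivity
    linarith
  · have h1 : μ * (2 * r ^ 2 * γ ^ 2) ≤ 7 / 16 * (γ * (r * (r * σ))) := by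
      calc μ * (2 * r ^ 2 * γ ^ 2) ≤ M / r * (2 * r ^ 2 * γ ^ 2) := by gcongr
        _ = 2 * M * γ * (r * γ) * 1 := by field_simp
        _ ≤ 7 / 16 * r * (r * γ) * σ := by
          refine mul_le_mul (mul_le_mul_of_nonneg_right ?_ (by positivity)) h.hσ zero_le_one
            (by positivity)
          linarith [h.small₇]
        _ = _ := by ring
    have h2 := mul_le_mul_of_nonneg_left hDb (by positivity : 0 ≤ γ * r)
    linarith
  · have h1 := mul_le_mul_of_nonneg_left hDu hα'.le
    have h2 := mul_le_mul_of_nonneg_right hM₂.le hu0.le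
    have h3 : 0 < c * (α - 1) * u := by positivity
    linarith

/-- Young's inequality for each of d, v, g, n separately. In `errorConst` the first summand serves
d, the second v and g, the third n. -/
theorem error_estimates (hα : 1 < α) (hγ : 0 < γ) (hc : 0 < c) (hp : 0 < p) (hk₁ : 0 ≤ k₁)
    (h : LargeTime α q γ s c k₁ k₂ M t r σ π m m' m'')
    {R N d v g n B a : ℝ} (hR : 0 ≤ R) (hN : 0 ≤ N) (hB0 : 0 ≤ B)
    (hB : B ≤ (α - 1) * 2) (ha0 : 0 ≤ a) (ha : a ≤ 3 * (m * (r * σ))) :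
    (a * r * (p / t * (c / π)) * R + R / t * (a * r * N + (α - 1) ^ 2 + B)) * d
        - c * (α - 1) / 16 * (r * σ / π) * d ^ 2
      ≤ errorConst α γ c p k₁ R N * (m * (r ^ 3 * σ * π / t ^ 2)) ∧
    R / t * ((α - 1) * (r * m)) * v - 1 / 4 * (r * m) * v ^ 2
      ≤ errorConst α γ c p k₁ R N * (m * (r ^ 3 * σ * π / t ^ 2)) ∧
    R / t * ((α - 1) * (r * γ)) * g - γ / 2 * (r * (r * σ)) * g ^ 2
      ≤ errorConst α γ c p k₁ R N * (m * (r ^ 3 * σ * π / t ^ 2)) ∧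
    R / t * n - c * (α - 1) / 16 * (r * σ / π) * n ^ 2
      ≤ errorConst α γ c p k₁ R N * (m * (r ^ 3 * σ * π / t ^ 2)) := by
  have ht : 0 < t := by linarith [h.ht]
  have hr : 0 < r := by linarith [h.hr]
  have hσ : 0 < σ := by linarith [h.hσ]
  have hπ : 0 < π := by linarith [h.hπ]
  have hm := h.hm
  have hα' : 0 < α - 1 := by linarith
  set κ := c * (α - 1) / 16 with hκ
  have hκ0 : 0 < κ := by positivity
  set C := errorConst α γ c p k₁ R N with hC
  set H := m * (r ^ 3 * σ * π / t ^ 2) with hH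
  have hH0 : 0 < H := by positivity
  set K := 3 * p * c * R + 3 * R * N + R * ((α - 1) ^ 2 + 2 * (α - 1)) / γ with hK
  have hK0 : 0 ≤ K := by positivity
  have hC1 : K ^ 2 * k₁ ≤ 4 * κ * C := by
    have : K ^ 2 * k₁ / (4 * κ) ≤ C := by
      rw [hC, errorConst]
      have h1 : 0 ≤ R ^ 2 * (α - 1) ^ 2 := by positivity
      have h2 : 0 ≤ R ^ 2 / (4 * κ * γ) := by positivity
      linarith
    rw [div_le_iff₀ (by positivity)] at this
    linarith
  have hC2 : R ^ 2 * (α - 1) ^ 2 ≤ C := by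
    rw [hC, errorConst]
    have h1 : 0 ≤ K ^ 2 * k₁ / (4 * κ) := by positivity
    have h2 : 0 ≤ R ^ 2 / (4 * κ * γ) := by positivity
    linarith
  have hC3 : R ^ 2 ≤ 4 * κ * γ * C := by
    have : R ^ 2 / (4 * κ * γ) ≤ C := by
      rw [hC, errorConst]
      have h1 : 0 ≤ R ^ 2 * (α - 1) ^ 2 := by positivity
      have h2 : 0 ≤ K ^ 2 * k₁ / (4 * κ) := by positivity
      linarith
    rw [div_le_iff₀ (by positivity)] at this
    linarith
  have hC0 : 0 ≤ C := le_trans (by positivity) hC2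
  have hr1 := h.hr
  have hσ1 := h.hσ
  have hπ1 := h.hπ
  have hup := h.hup
  have low : γ ≤ m * (r * σ) := h.hlow
  have lowr : γ ≤ m * (r * σ) * r := low.trans (le_mul_of_one_le_right (by positivity) hr1)
  clear h
  set b := a * r * (p / t * (c / π)) * R + R / t * (a * r * N + (α - 1) ^ 2 + B)
    with hbdef
  have hb0 : 0 ≤ b := by
    have := mul_nonneg ha0 hr.le
    positivity
  have hbK : b ≤ K * (m * r ^ 2 * σ / t) := by
    have h1 : a * r ≤ 3 * (m * (r * σ)) * r := mul_le_mul_of_nonneg_right ha hr.le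
    have h2 : c / π ≤ c := div_le_self hc.le hπ1
    have h3 : a * r * (p / t * (c / π)) * R ≤ 3 * (m * (r * σ)) * r * (p / t * c) * R := by
      gcongr
    have h4 : R / t * (a * r * N) ≤ R / t * (3 * (m * (r * σ)) * r * N) := by gcongr
    -- These terms carry no factor m; the lower mass bound supplies one through 1 ≤ m r²σ/γ.
    have h5 : R / t * ((α - 1) ^ 2 + B)
        ≤ R / t * ((α - 1) ^ 2 + 2 * (α - 1)) * (m * (r * σ) * r / γ) := by
      have i1 : 1 ≤ m * (r * σ) * r / γ := (one_le_div hγ).2 lowr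
      refine le_trans ?_ (le_mul_of_one_le_right (by positivity) i1)
      gcongr
      linarith
    have h6 : K * (m * r ^ 2 * σ / t) = 3 * (m * (r * σ)) * r * (p / t * c) * R
        + R / t * (3 * (m * (r * σ)) * r * N)
        + R / t * ((α - 1) ^ 2 + 2 * (α - 1)) * (m * (r * σ) * r / γ) := by
      rw [hK]; field_simp
    rw [h6, hbdef]
    linarith
  clear_value C K
  have y1 : b * d - κ * (r * σ / π) * d ^ 2 ≤ C * H := by
    refine young_le (by positivity) ?_
    calc b ^ 2 ≤ (K * (m * r ^ 2 * σ / t)) ^ 2 := pow_le_pow_left₀ hb0 hbK 2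
      _ = K ^ 2 * (m * r) * (m * r ^ 3 * σ ^ 2 / t ^ 2) := by ring
      _ ≤ K ^ 2 * k₁ * (m * r ^ 3 * σ ^ 2 / t ^ 2) := by gcongr
      _ ≤ 4 * κ * C * (m * r ^ 3 * σ ^ 2 / t ^ 2) := by gcongr
      _ ≤ 4 * κ * C * (m * r ^ 3 * σ ^ 2 / t ^ 2) * r :=
        le_mul_of_one_le_right (by positivity) hr1
      _ = 4 * (κ * (r * σ / π)) * (C * H) := by rw [hH]; field_simp
  have y2 : R / t * ((α - 1) * (r * m)) * v - 1 / 4 * (r * m) * v ^ 2 ≤ C * H := by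
    refine young_le (by positivity) ?_
    have : 1 ≤ r ^ 2 * (σ * π) := one_le_mul_of_one_le_of_one_le (one_le_pow₀ hr1)
      (one_le_mul_of_one_le_of_one_le hσ1 hπ1)
    calc (R / t * ((α - 1) * (r * m))) ^ 2
        = R ^ 2 * (α - 1) ^ 2 * (r ^ 2 * m ^ 2 / t ^ 2) := by ring
      _ ≤ C * (r ^ 2 * m ^ 2 / t ^ 2) := by gcongr
      _ ≤ C * (r ^ 2 * m ^ 2 / t ^ 2) * (r ^ 2 * (σ * π)) :=
        le_mul_of_one_le_right (by positivity) this
      _ = 4 * (1 / 4 * (r * m)) * (C * H) := by rw [hH]; ring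
  have y3 : R / t * ((α - 1) * (r * γ)) * g - γ / 2 * (r * (r * σ)) * g ^ 2 ≤ C * H := by
    refine young_le (by positivity) ?_
    have h1 : 1 ≤ r ^ 2 * (σ * π) := one_le_mul_of_one_le_of_one_le (one_le_pow₀ hr1)
      (one_le_mul_of_one_le_of_one_le hσ1 hπ1)
    calc (R / t * ((α - 1) * (r * γ))) ^ 2
        = R ^ 2 * (α - 1) ^ 2 * (r ^ 2 * γ / t ^ 2) * γ := by ring
      _ ≤ C * (r ^ 2 * γ / t ^ 2) * (m * (r * σ)) := by gcongr
      _ ≤ C * (r ^ 2 * γ / t ^ 2) * (m * (r * σ)) * (r ^ 2 * (σ * π)) :=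
        le_mul_of_one_le_right (by positivity) h1
      _ ≤ 2 * (C * (r ^ 2 * γ / t ^ 2) * (m * (r * σ)) * (r ^ 2 * (σ * π))) :=
        le_mul_of_one_le_left (by positivity) one_le_two
      _ = 4 * (γ / 2 * (r * (r * σ))) * (C * H) := by rw [hH]; ring
  have y4 : R / t * n - κ * (r * σ / π) * n ^ 2 ≤ C * H := by
    refine young_le (by positivity) ?_
    have h1 : 1 ≤ r ^ 3 * σ := one_le_mul_of_one_le_of_one_le (one_le_pow₀ hr1) hσ1
    calc (R / t) ^ 2 = R ^ 2 / t ^ 2 := by ring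
      _ ≤ 4 * κ * γ * C / t ^ 2 := by gcongr
      _ = 4 * κ * C / t ^ 2 * γ := by ring
      _ ≤ 4 * κ * C / t ^ 2 * (m * (r * σ)) := by gcongr
      _ ≤ 4 * κ * C / t ^ 2 * (m * (r * σ)) * (r ^ 3 * σ) :=
        le_mul_of_one_le_right (by positivity) h1
      _ = 4 * (κ * (r * σ / π)) * (C * H) := by rw [hH]; field_simp
  exact ⟨y1, y2, y3, y4⟩

/-- Adds the coefficient bounds to the four Young estimates, whence the factor 4. -/
theorem energy_inequality (hα : 1 < α) (hq : 0 < q) (hγ : 0 < γ)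
    (hc : 0 < c) (hp : 0 < p) (hk₁ : 0 ≤ k₁) (hk₂ : 0 ≤ k₂) (hM : 0 < M)
    (hM₁ : M * (2 * α - 1) < 3 * c / 4) (hM₂ : M < c * (α - 1))
    (h : LargeTime α q γ s c k₁ k₂ M t r σ π m m' m'')
    {μ R N d v g n Δ E E' β D a A' B' : ℝ} (hμ₀ : 0 ≤ μ) (hμ₁ : μ ≤ M / r)
    (hμ₂ : μ ≤ M * (r * σ / π)) (hR : 0 ≤ R) (hN : 0 ≤ N)
    (hΔ : c / π / 2 * d ^ 2 ≤ Δ)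
    (hβ : β = q * m * (r / t) + m' * r - 1)
    (hD : D = r * σ - γ * (q * (r / t)))
    (ha : a = m * D - γ * β)
    (hA' : A' ≤ (α - 1) / 4 * (r * σ))
    (hB' : B' ≤ (α - 1) * (c / 32 * (r * σ / π)))
    (hE : E ≤ a * r * Δ + (α - 1) ^ 2 * d ^ 2 + 2 * r ^ 2 * (m ^ 2 * v ^ 2 + γ ^ 2 * g ^ 2)
        + 1 / 2 * |-(α - 1) * β| * d ^ 2 + 1 / 2 * n ^ 2)
    (hE' : E' ≤ A' * Δ - (α - 1) * D * (Δ + c / π / 2 * d ^ 2)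
        + a * r * (p / t * (c / π)) * R * d + r * m * β * v ^ 2 - γ * D * r * g ^ 2
        + 1 / 2 * B' * d ^ 2 - (α - 1) * D * (c / π) * n ^ 2
        + R / t * (a * r * (N * d) + (α - 1) * ((α - 1) * d + r * (m * v + γ * g))
          + |-(α - 1) * β| * d + n)) :
    E' + μ * E ≤ 4 * errorConst α γ c p k₁ R N * (m * (r ^ 3 * σ * π / t ^ 2)) := by
  have ht : 0 < t := by linarith [h.ht]
  have hr : 0 < r := by linarith [h.hr]
  have hσ : 0 < σ := by linarith [h.hσ]
  have hπ : 0 < π := by linarith [h.hπ]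
  have hm := h.hm
  have hα' : 0 < α - 1 := by linarith
  have hb := h.beta_bounds hq hk₂
  have hDb := h.scale_bounds hq hγ
  have hab := h.coef_bounds hq hγ hk₂
  rw [← hβ, ← hD] at *
  rw [← ha] at hab
  have habs : |-(α - 1) * β| ≤ (α - 1) * (33 / 32) := by
    rw [abs_mul, abs_neg, abs_of_pos hα', abs_of_neg (by linarith)]
    exact mul_le_mul_of_nonneg_left (by linarith) hα'.le
  have hΔ0 : 0 ≤ Δ := le_trans (by positivity) hΔ
  obtain ⟨c1, c2, c3, c4, c5⟩ := h.coef_estimates hα hγ hc hM hM₁ hM₂ hμ₁ hμ₂ hΔ0 hb.2 habs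
    hDb.1 hab hA' hB'
  obtain ⟨y1, y2, y3, y4⟩ := h.error_estimates (d := d) (v := v) (g := g) (n := n) hα hγ hc hp hk₁
    hR hN (abs_nonneg _) (habs.trans (mul_le_mul_of_nonneg_left (by norm_num) hα'.le)) hab.1 hab.2
  have z2 := mul_le_mul_of_nonneg_right c2 (sq_nonneg d)
  have z3 := mul_le_mul_of_nonneg_right c3 (sq_nonneg v)
  have z4 := mul_le_mul_of_nonneg_right c4 (sq_nonneg g)
  have z5 := mul_le_mul_of_nonneg_right c5 (sq_nonneg n)
  have zE := mul_le_mul_of_nonneg_left hE hμ₀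
  refine le_trans (add_le_add hE' zE) ?_
  generalize errorConst α γ c p k₁ R N = C at *
  generalize m * (r ^ 3 * σ * π / t ^ 2) = H at *
  generalize |-(α - 1) * β| = B at *
  generalize c * (α - 1) / 16 * (r * σ / π) = κ at *
  linarith only [c1, z2, z3, z4, z5, y1, y2, y3, y4]

end LargeTime

/-! ### Large times and regularity of the energy. -/

namespace LipschitzNear

theorem mul {g k : ℝ → ℝ} {t : ℝ} (hg : LipschitzNear g t) (hk : LipschitzNear k t) :
    LipschitzNear (fun τ => g τ * k τ) t :=
  (hg.prodMk hk).contDiff_comp contDiff_mul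

theorem add {g k : ℝ → ℝ} {t : ℝ} (hg : LipschitzNear g t) (hk : LipschitzNear k t) :
    LipschitzNear (fun τ => g τ + k τ) t :=
  (hg.prodMk hk).contDiff_comp contDiff_add

theorem sub {g k : ℝ → ℝ} {t : ℝ} (hg : LipschitzNear g t) (hk : LipschitzNear k t) :
    LipschitzNear (fun τ => g τ - k τ) t :=
  (hg.prodMk hk).contDiff_comp (contDiff_fst.sub contDiff_snd)

theorem const (a t : ℝ) : LipschitzNear (fun _ : ℝ => a) t :=
  ⟨0, univ, univ_mem, LipschitzWith.lipschitzOnWith (LipschitzWith.const a)⟩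

theorem rpow (a : ℝ) {t : ℝ} (ht : 0 < t) : LipschitzNear (fun τ : ℝ => τ ^ a) t :=
  (Real.contDiffAt_rpow_const (Or.inl ht.ne')).exists_lipschitzOnWith

end LipschitzNear

namespace PDSystem

set_option linter.unusedSectionVars false

variable {X Y : Type*} [NormedAddCommGroup X] [InnerProductSpace ℝ X] [CompleteSpace X]
  [NormedAddCommGroup Y] [InnerProductSpace ℝ Y] [CompleteSpace Y]

/-- The times at which the mass is twice differentiable and all coefficients are in the range
required by the energy estimate. -/
structure LargeTimeAt (S : PDSystem X Y) (k₁ k₂ M t : ℝ) : Prop where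
  lt : S.t₀ < t
  diff : TimeDiffAt S.t₀ S.mdot t
  large : LargeTime S.α S.q S.γ S.s S.c k₁ k₂ M t (t ^ S.q) (t ^ S.s) (t ^ S.p)
    (S.m t) (S.mdot t) (S.mddot t)

theorem eventually_largeTimeAt (S : PDSystem X Y) (hα : 1 < S.α) (hq₀ : 0 < S.q)
    (hs : 0 < S.s) (hc : 0 < S.c) (hp₀ : 0 < S.p) (hp₁ : S.p < 1)
    (hm_pos : ∀ t, S.t₀ ≤ t → 0 < S.m t) (hm_bound : S.MassBound) (hm_deriv : S.MassDerivBound)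
    (M : ℝ) : ∃ k₁ k₂ : ℝ, 0 ≤ k₁ ∧ 0 ≤ k₂ ∧ ∀ᶠ t in atTop, S.LargeTimeAt k₁ k₂ M t := by
  obtain ⟨k₁, hk₁, hb⟩ := hm_bound
  obtain ⟨k₂, hk₂, hd⟩ := hm_deriv
  refine ⟨k₁, k₂, hk₁.le, hk₂.le, ?_⟩
  have hr := tendsto_rpow_atTop hq₀
  have hlin : ∀ a b : ℝ, 0 < b → ∀ᶠ t : ℝ in atTop, a ≤ b * t := fun a b hb' =>
    (tendsto_id.const_mul_atTop hb').eventually_ge_atTop a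
  have hpow : ∀ a b : ℝ, 0 < b → ∀ᶠ t : ℝ in atTop, a ≤ b * t ^ S.q := fun a b hb' =>
    (hr.const_mul_atTop hb').eventually_ge_atTop a
  have hα' : 0 < S.α - 1 := by linarith
  filter_upwards [hb, hd, eventually_gt_atTop S.t₀, eventually_ge_atTop (1 : ℝ),
    eventually_ge_atTop (16 * S.γ * S.q), eventually_ge_atTop (32 * ((S.q + k₂) * k₁)),
    hlin (32 * ((2 * S.q * k₂ + S.q + k₂) * k₁)) S.c hc,
    hlin (4 * ((k₂ + 4 * S.q + S.s) * k₁ + 2 * S.γ * S.q * (k₂ + 1) * k₁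
      + S.γ * k₂ * (1 + S.q) * k₁)) (S.α - 1) hα',
    hpow (12 * M * k₁) (S.α - 1) hα', hr.eventually_ge_atTop (8 * M * k₁),
    hpow (32 * M * S.γ) 7 (by norm_num)] with t h1 h2 h3 h4 h5 h6 h7 h8 h9 h10 h11
  have ht : 0 < t := by linarith
  have hm := hm_pos t h3.le
  refine ⟨h3, h2.1, ?_⟩
  exact
    { ht := h4
      hr := Real.one_le_rpow h4 hq₀.le
      hσ := Real.one_le_rpow h4 hs.le
      hπ := Real.one_le_rpow h4 hp₀.le
      hπt := by simpa using Real.rpow_le_rpow_of_exponent_le h4 hp₁.le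
      hm := hm
      hlow := by
        have := h1.1
        rwa [div_le_iff₀ (Real.rpow_pos_of_pos ht _), Real.rpow_add ht] at this
      hup := by
        have := h1.2
        rwa [le_div_iff₀ (Real.rpow_pos_of_pos ht _)] at this
      hm' := by rw [le_div_iff₀ ht, mul_comm]; exact h2.2.1
      hm'' := by rw [le_div_iff₀ (by positivity), mul_comm]; exact h2.2.2
      small₁ := h5
      small₂ := h6
      small₃ := h7
      small₄ := h8
      small₅ := h9
      small₆ := h10
      small₇ := h11 }

section Derivatives

variable {S : PDSystem X Y} {k₁ k₂ M t : ℝ}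

theorem hasDerivAt_coefB (ht₀ : 0 < S.t₀) (hm_diff : ∀ t, S.t₀ ≤ t → TimeDiffAt S.t₀ S.m t)
    (ht : S.LargeTimeAt k₁ k₂ M t) :
    HasDerivAt S.coefB (-(S.α - 1) * (S.q * (S.mdot t * (t ^ S.q / t)
        + S.m t * ((S.q - 1) * (t ^ S.q / t / t)))
        + (S.mddot t * t ^ S.q + S.mdot t * (S.q * (t ^ S.q / t))))) t := by
  have h0 := (ht₀.trans ht.lt).ne'
  have hm : HasDerivAt S.m (S.mdot t) t := (hm_diff t ht.lt.le).hasDerivAt ht.lt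
  have hmd : HasDerivAt S.mdot (S.mddot t) t := ht.diff.hasDerivAt ht.lt
  have h1 := Real.hasDerivAt_rpow_const (p := S.q - 1) (Or.inl h0)
  have h2 := Real.hasDerivAt_rpow_const (p := S.q) (Or.inl h0)
  refine (((((hm.const_mul S.q).mul h1).add (hmd.mul h2)).sub_const 1).const_mul
    (-(S.α - 1))).congr_deriv ?_
  rw [Real.rpow_sub_one h0 (S.q - 1), Real.rpow_sub_one h0 S.q]
  ring

theorem hasDerivAt_coefA_mul (ht₀ : 0 < S.t₀) (hm_diff : ∀ t, S.t₀ ≤ t → TimeDiffAt S.t₀ S.m t)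
    (ht : S.LargeTimeAt k₁ k₂ M t) :
    HasDerivAt (fun τ => S.coefA τ * τ ^ S.q)
      ((S.mdot t * (t ^ S.q * t ^ S.s) + S.m t * ((S.q + S.s) * (t ^ S.q * t ^ S.s / t))
        - 2 * S.γ * S.q * (S.mdot t * (t ^ S.q / t) + S.m t * ((S.q - 1) * (t ^ S.q / t / t)))
        - S.γ * (S.mddot t * t ^ S.q + S.mdot t * (S.q * (t ^ S.q / t)))) * t ^ S.q
      + (S.m t * (t ^ S.q * t ^ S.s - S.γ * (S.q * (t ^ S.q / t)))
        - S.γ * (S.q * S.m t * (t ^ S.q / t) + S.mdot t * t ^ S.q - 1))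
        * (S.q * (t ^ S.q / t))) t := by
  have ht0 := ht₀.trans ht.lt
  have h0 := ht0.ne'
  have hm : HasDerivAt S.m (S.mdot t) t := (hm_diff t ht.lt.le).hasDerivAt ht.lt
  have hmd : HasDerivAt S.mdot (S.mddot t) t := ht.diff.hasDerivAt ht.lt
  have h1 := Real.hasDerivAt_rpow_const (p := S.q - 1) (Or.inl h0)
  have h2 := Real.hasDerivAt_rpow_const (p := S.q) (Or.inl h0)
  have h3 := Real.hasDerivAt_rpow_const (p := S.q + S.s) (Or.inl h0)
  have h4 : HasDerivAt S.coefA _ t :=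
    (((hm.mul h3).sub ((hm.const_mul (2 * S.γ * S.q)).mul h1)).sub
      ((hmd.const_mul S.γ).mul h2)).add_const S.γ
  refine (h4.mul h2).congr_deriv ?_
  rw [S.coefA_eq ht0, S.dualScale_eq ht0, Real.rpow_sub_one h0 (S.q - 1), Real.rpow_sub_one h0 S.q,
    Real.rpow_sub_one h0 (S.q + S.s), Real.rpow_add ht0]
  ring

theorem dualScale_pos (ht₀ : 0 < S.t₀) (hq₀ : 0 < S.q) (hγ : 0 < S.γ)
    (ht : S.LargeTimeAt k₁ k₂ M t) : 0 < S.dualScale t := by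
  have ht0 := ht₀.trans ht.lt
  have h := (ht.large.scale_bounds hq₀ hγ).1
  rw [S.dualScale_eq ht0, Real.rpow_sub_one ht0.ne']
  have h1 := Real.rpow_pos_of_pos ht0 S.q
  have h2 := Real.rpow_pos_of_pos ht0 S.s
  exact lt_of_lt_of_le (by positivity) h

theorem coefA_nonneg (ht₀ : 0 < S.t₀) (hq₀ : 0 < S.q) (hγ : 0 < S.γ) (hk₂ : 0 ≤ k₂)
    (ht : S.LargeTimeAt k₁ k₂ M t) : 0 ≤ S.coefA t := by
  have ht0 := ht₀.trans ht.lt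
  rw [S.coefA_eq ht0, S.dualScale_eq ht0, Real.rpow_sub_one ht0.ne']
  exact (ht.large.coef_bounds hq₀ hγ hk₂).1

end Derivatives

section Regularity

variable {S : PDSystem X Y} {k₁ k₂ M T : ℝ} {x : ℝ → X} {l : ℝ → Y}

theorem lipschitzNear_mass (hm_diff : ∀ t, S.t₀ ≤ t → TimeDiffAt S.t₀ S.m t)
    (hT : ∀ t, T ≤ t → S.LargeTimeAt k₁ k₂ M t) {t : ℝ} (ht : T < t) : LipschitzNear S.m t := by
  refine LipschitzNear.of_hasDerivAt (g' := S.mdot) ?_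
    ((hT t ht.le).diff.hasDerivAt (hT t ht.le).lt).continuousAt
  filter_upwards [lt_mem_nhds ht] with τ hτ
  exact (hm_diff τ (hT τ hτ.le).lt.le).hasDerivAt (hT τ hτ.le).lt

/-- The second derivative of the mass is only known to exist and be bounded, so the
bounded-derivative criterion is used instead of continuity. -/
theorem lipschitzNear_mdot (hk₂ : 0 ≤ k₂)
    (hT : ∀ t, T ≤ t → S.LargeTimeAt k₁ k₂ M t) {t : ℝ} (ht : T < t) :
    LipschitzNear S.mdot t := by
  refine LipschitzNear.of_hasDerivAt_le (g' := S.mddot) (K := k₂ * k₁) ?_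
  filter_upwards [lt_mem_nhds ht] with τ hτ
  have h := hT τ hτ.le
  refine ⟨h.diff.hasDerivAt h.lt, ?_⟩
  have hτ1 := h.large.ht
  have h1 : S.m τ ≤ k₁ :=
    (le_mul_of_one_le_right h.large.hm.le h.large.hr).trans h.large.hup
  rw [Real.norm_eq_abs]
  calc |S.mddot τ| ≤ k₂ * S.m τ / τ ^ 2 := h.large.hm''
    _ ≤ k₂ * S.m τ :=
      div_le_self (mul_nonneg hk₂ h.large.hm.le) (one_le_pow₀ hτ1)
    _ ≤ k₂ * k₁ := by gcongr

theorem lipschitzNear_coefA (ht₀ : 0 < S.t₀) (hm_diff : ∀ t, S.t₀ ≤ t → TimeDiffAt S.t₀ S.m t)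
    (hk₂ : 0 ≤ k₂) (hT : ∀ t, T ≤ t → S.LargeTimeAt k₁ k₂ M t) {t : ℝ}
    (ht : T < t) : LipschitzNear S.coefA t := by
  have ht0 : 0 < t := ht₀.trans (hT t ht.le).lt
  have hm := lipschitzNear_mass hm_diff hT ht
  have hmd := lipschitzNear_mdot hk₂ hT ht
  exact (((hm.mul (.rpow _ ht0)).sub (((LipschitzNear.const (2 * S.γ * S.q) t).mul hm).mul
    (.rpow _ ht0))).sub (((LipschitzNear.const S.γ t).mul hmd).mul (.rpow _ ht0))).add (.const _ t)

theorem lipschitzNear_coefB (ht₀ : 0 < S.t₀) (hm_diff : ∀ t, S.t₀ ≤ t → TimeDiffAt S.t₀ S.m t)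
    (hk₂ : 0 ≤ k₂) (hT : ∀ t, T ≤ t → S.LargeTimeAt k₁ k₂ M t) {t : ℝ}
    (ht : T < t) : LipschitzNear S.coefB t := by
  have ht0 : 0 < t := ht₀.trans (hT t ht.le).lt
  have hm := lipschitzNear_mass hm_diff hT ht
  have hmd := lipschitzNear_mdot hk₂ hT ht
  exact (LipschitzNear.const (-(S.α - 1)) t).mul
    (((((LipschitzNear.const S.q t).mul hm).mul (.rpow _ ht0)).add
      (hmd.mul (.rpow _ ht0))).sub (.const 1 t))

theorem lipschitzNear_tikh {t : ℝ} (ht0 : 0 < t) : LipschitzNear S.tikh t := by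
  refine LipschitzNear.of_hasDerivAt (g' := fun τ => -(S.p / τ * S.tikh τ)) ?_ ?_
  · filter_upwards [lt_mem_nhds ht0] with τ hτ using S.hasDerivAt_tikh hτ
  · have := (S.hasDerivAt_tikh ht0).continuousAt
    have h0 := ht0.ne'
    fun_prop (disch := assumption)

theorem lipschitzNear_primal (hsol : S.IsGlobalSolution x l) {t : ℝ} (ht : S.t₀ < t) :
    LipschitzNear x t := by
  refine LipschitzNear.of_hasDerivAt (g' := timeDeriv S.t₀ x) ?_
    ((hsol.diff_xdot t ht.le).hasDerivAt ht).continuousAt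
  filter_upwards [lt_mem_nhds ht] with τ hτ using (hsol.diff_x τ hτ.le).hasDerivAt hτ

/-- ẍ and the derivative of the gradient are only assumed to exist; the combination given by the
primal equation is continuous. -/
theorem lipschitzNear_momentum (ht₀ : 0 < S.t₀)
    (hm_diff : ∀ t, S.t₀ ≤ t → TimeDiffAt S.t₀ S.m t) (hsol : S.IsGlobalSolution x l)
    (hT : ∀ t, T ≤ t → S.LargeTimeAt k₁ k₂ M t) {t : ℝ} (ht : T < t) :
    LipschitzNear (S.momentum x l) t := by
  have h := hT t ht.le
  have ht0 : 0 < t := ht₀.trans h.lt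
  refine LipschitzNear.of_hasDerivAt (g' := fun τ => (S.mdot τ - S.α / τ ^ S.q) •
    timeDeriv S.t₀ x τ - τ ^ S.s • S.gradX τ (x τ) (l τ)) ?_ ?_
  · filter_upwards [lt_mem_nhds h.lt] with τ hτ using hasDerivAt_momentum hsol hm_diff hτ
  · have c1 := ((hsol.diff_xdot t h.lt.le).hasDerivAt h.lt).continuousAt
    have c2 := ((hsol.diff_grad t h.lt.le).hasDerivAt h.lt).continuousAt
    have c3 := (h.diff.hasDerivAt h.lt).continuousAt
    have c4 := (LipschitzNear.rpow S.q ht0).continuousAt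
    have c5 := (LipschitzNear.rpow S.s ht0).continuousAt
    have h0 := (Real.rpow_pos_of_pos ht0 S.q).ne'
    exact ((c3.sub (continuousAt_const.div c4 h0)).smul c1).sub (c5.smul c2)

/-- By `theta_mul` the derivative of the multiplier is written without a quotient, and its
continuity is then visible. -/
theorem lipschitzNear_dual (ht₀ : 0 < S.t₀) (hα : 1 < S.α) (hq₀ : 0 < S.q) (hγ : 0 < S.γ)
    (hm_diff : ∀ t, S.t₀ ≤ t → TimeDiffAt S.t₀ S.m t) (hk₂ : 0 ≤ k₂)
    (hsol : S.IsGlobalSolution x l)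
    (hT : ∀ t, T ≤ t → S.LargeTimeAt k₁ k₂ M t) {t : ℝ} (ht : T < t) :
    LipschitzNear l t := by
  have h := hT t ht.le
  have ht0 : 0 < t := ht₀.trans h.lt
  refine LipschitzNear.of_hasDerivAt (g' := fun τ => ((S.α - 1) * S.dualScale τ) •
    (S.A (x τ) - S.b - S.tikh τ • l τ) + (S.coefA τ * τ ^ S.q) • S.A (timeDeriv S.t₀ x τ)) ?_ ?_
  · filter_upwards [lt_mem_nhds ht] with τ hτ
    have hτ' := hT τ hτ.le
    have hD := (dualScale_pos ht₀ hq₀ hγ hτ').ne'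
    refine (hasDerivAt_dual hsol hτ'.lt hD).congr_deriv ?_
    rw [← S.theta_mul (ht₀.trans hτ'.lt) hα hD, map_add, map_smul]
    module
  · have c1 := ((hsol.diff_xdot t h.lt.le).hasDerivAt h.lt).continuousAt
    have c2 := ((hsol.diff_x t h.lt.le).hasDerivAt h.lt).continuousAt
    have c3 := ((hsol.diff_l t h.lt.le).hasDerivAt h.lt).continuousAt
    have c4 := (LipschitzNear.rpow S.q ht0).continuousAt
    have c5 := (lipschitzNear_coefA ht₀ hm_diff hk₂ hT ht).continuousAt
    have c6 := (lipschitzNear_tikh (S := S) ht0).continuousAt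
    have c7 : ContinuousAt S.dualScale t :=
      (((LipschitzNear.rpow (S.q + S.s) ht0).sub
        ((LipschitzNear.const (S.γ * S.q) t).mul (.rpow (S.q - 1) ht0))).continuousAt)
    have c8 : ContinuousAt (fun τ => S.A (x τ)) t := S.A.continuous.continuousAt.comp c2
    have c9 : ContinuousAt (fun τ => S.A (timeDeriv S.t₀ x τ)) t :=
      S.A.continuous.continuousAt.comp c1
    exact ((continuousAt_const.mul c7).smul ((c8.sub continuousAt_const).sub (c6.smul c3))).add
      ((c5.mul c4).smul c9)

end Regularity

end PDSystem

/-! ### Assembly of the main estimate. -/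

theorem mainTheorem2 {X Y : Type*}
    [NormedAddCommGroup X] [InnerProductSpace ℝ X] [CompleteSpace X]
    [NormedAddCommGroup Y] [InnerProductSpace ℝ Y] [CompleteSpace Y]
    (S : PDSystem X Y)
    -- the problem: `f` convex and continuously differentiable, with a primal-dual solution
    (hf_convex : ConvexOn ℝ univ S.f) (hf_smooth : ContDiff ℝ 1 S.f)
    (hΩ : ∃ (xbar : X) (lbar : Y), IsSaddlePoint S.lagrangian xbar lbar)
    -- the parameters
    (ht₀ : 0 < S.t₀) (hα : 1 < S.α) (hq₀ : 0 < S.q) (hq₁ : S.q < 1) (hγ : 0 < S.γ)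
    (hs : 0 < S.s) (hc : 0 < S.c) (hp₀ : 0 < S.p) (hp₁ : S.p < 1)
    -- the mass
    (hm_pos : ∀ t, S.t₀ ≤ t → 0 < S.m t)
    (hm_diff : ∀ t, S.t₀ ≤ t → TimeDiffAt S.t₀ S.m t)
    (hm_anti : AntitoneOn S.m (Ici S.t₀))
    (hm_bound : S.MassBound) (hm_deriv : S.MassDerivBound)
    -- the trajectory and the saddle points of the regularized Lagrangians
    (x : ℝ → X) (l : ℝ → Y) (hsol : S.IsGlobalSolution x l)
    (xs : ℝ → X) (ls : ℝ → Y)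
    (hsaddle : ∀ t, S.t₀ ≤ t → IsSaddlePoint (S.regLagrangian t) (xs t) (ls t))
    -- the constant `M`
    (a₁ M : ℝ) (ha₁ : 0 < a₁) (hM₀ : 0 < M)
    (hM : M < min (3 * S.c / (4 * (2 * S.α - 1))) (S.c * (S.α - 1) - 1 / a₁)) :
    ∃ C₀ : ℝ, 0 ≤ C₀ ∧ ∃ T : ℝ, S.t₀ ≤ T ∧
      -- regularity of the energy for large times
      LocallyLipschitzOn (Ici T) (S.energy x l xs ls) ∧
      (∀ᵐ t : ℝ, T ≤ t → TimeDiffAt S.t₀ (S.energy x l xs ls) t) ∧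
      (∀ t : ℝ, T ≤ t → TimeDiffAt S.t₀ xs t → TimeDiffAt S.t₀ ls t →
        TimeDiffAt S.t₀ (S.energy x l xs ls) t) ∧
      -- the differential inequality, wherever the energy is differentiable
      ∀ t : ℝ, T ≤ t → TimeDiffAt S.t₀ (S.energy x l xs ls) t →
        timeDeriv S.t₀ (S.energy x l xs ls) t
            + M / t ^ (max S.q (S.p - S.q - S.s)) * S.energy x l xs ls t
          ≤ C₀ * (S.m t * t ^ (3 * S.q + S.s + S.p - 2)
              + S.m t * t ^ (S.q + S.s - S.p - 1)) := by
  have hα' : 0 < 2 * S.α - 1 := by linarith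
  have hM₁ : M * (2 * S.α - 1) < 3 * S.c / 4 := by
    have := hM.trans_le (min_le_left _ _)
    rw [lt_div_iff₀ (by positivity)] at this
    linarith
  have hM₂ : M < S.c * (S.α - 1) := by
    have h1 := hM.trans_le (min_le_right _ _)
    have h2 : 0 < 1 / a₁ := by positivity
    linarith
  obtain ⟨R, hR0, hRb, hR⟩ :=
    PDSystem.exists_saddle_bounds hf_convex hf_smooth hΩ ht₀ hc hp₀ hp₁ hsaddle
  obtain ⟨k₁, k₂, hk₁, hk₂, hev⟩ :=
    S.eventually_largeTimeAt hα hq₀ hs hc hp₀ hp₁ hm_pos hm_bound hm_deriv M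
  obtain ⟨T, hT⟩ := eventually_atTop.1 hev
  -- Starting at T + 1 keeps a full neighbourhood of each time inside the range of large times.
  have hTt : ∀ {t}, T + 1 ≤ t → T < t := fun h => by linarith
  have hlt : ∀ {t}, T + 1 ≤ t → S.t₀ < t := fun h => (hT _ (hTt h).le).lt
  have hlx : ∀ {t}, S.t₀ < t → LipschitzNear xs t := fun {t} ht =>
    LipschitzNear.of_forall_ge (K := R / S.t₀) ht fun τ τ' hτ hle =>
      (hR τ τ' hτ hle).1.trans (by have := sub_nonneg.2 hle; gcongr)
  have hll : ∀ {t}, S.t₀ < t → LipschitzNear ls t := fun {t} ht =>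
    LipschitzNear.of_forall_ge (K := R / S.t₀) ht fun τ τ' hτ hle =>
      (hR τ τ' hτ hle).2.trans (by have := sub_nonneg.2 hle; gcongr)
  have hreg := S.contDiff_energyFun hf_smooth
  have henergy : S.energy x l xs ls = fun t => _ :=
    funext fun t => S.energy_eq_energyFun x l xs ls t
  have hlip : ∀ t ∈ Ici (T + 1), LipschitzNear (S.energy x l xs ls) t := by
    intro t ht
    have ht1 := hTt ht
    have ht2 := hlt ht
    have ht0 := ht₀.trans ht2
    rw [henergy]
    -- The nine factors follow the argument order of `energyFun`.
    exact (((PDSystem.lipschitzNear_coefA ht₀ hm_diff hk₂ hT ht1).mul (.rpow S.q ht0)).prodMk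
      ((PDSystem.lipschitzNear_tikh ht0).prodMk
      ((PDSystem.lipschitzNear_coefB ht₀ hm_diff hk₂ hT ht1).prodMk
      ((LipschitzNear.rpow S.q ht0).prodMk
      ((PDSystem.lipschitzNear_primal hsol ht2).prodMk
      ((PDSystem.lipschitzNear_momentum ht₀ hm_diff hsol hT ht1).prodMk
      ((PDSystem.lipschitzNear_dual ht₀ hα hq₀ hγ hm_diff hk₂ hsol hT ht1).prodMk
      ((hlx ht2).prodMk (hll ht2))))))))).contDiff_comp hreg
  refine ⟨4 * LargeTime.errorConst S.α S.γ S.c S.p k₁ R ‖S.A‖, ?_, T + 1,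
    (hlt le_rfl).le, locallyLipschitzOn_of_lipschitzNear hlip, ?_, ?_, ?_⟩
  · have : 0 < S.α - 1 := by linarith
    rw [LargeTime.errorConst]
    positivity
  · filter_upwards [ae_differentiableAt_of_lipschitzNear hlip] with t ht hTt'
    exact (timeDiffAt_iff (hlt hTt')).2 (ht hTt')
  · intro t ht hdx hdl
    have h := hT t (hTt ht).le
    have ht2 := hlt ht
    have ht0 := ht₀.trans ht2
    rw [timeDiffAt_iff ht2] at hdx hdl ⊢
    rw [henergy]
    have hD := (PDSystem.dualScale_pos ht₀ hq₀ hγ h).ne'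
    exact (hreg.differentiable one_ne_zero _).comp t
      ((PDSystem.hasDerivAt_coefA_mul ht₀ hm_diff h).differentiableAt.prodMk
      ((S.hasDerivAt_tikh ht0).differentiableAt.prodMk
      ((PDSystem.hasDerivAt_coefB ht₀ hm_diff h).differentiableAt.prodMk
      ((Real.hasDerivAt_rpow_const (p := S.q) (Or.inl ht0.ne')).differentiableAt.prodMk
      (((hsol.diff_x t ht2.le).hasDerivAt ht2).differentiableAt.prodMk
      ((PDSystem.hasDerivAt_momentum hsol hm_diff ht2).differentiableAt.prodMk
      ((PDSystem.hasDerivAt_dual hsol ht2 hD).differentiableAt.prodMk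
      (hdx.prodMk hdl))))))))
  · intro t ht hE
    have h := hT t (hTt ht).le
    have ht2 := hlt ht
    have ht0 := ht₀.trans ht2
    have hr := Real.rpow_pos_of_pos ht0 S.q
    have hσ := Real.rpow_pos_of_pos ht0 S.s
    have hπ := Real.rpow_pos_of_pos ht0 S.p
    have hq1 : t ^ (S.q - 1) = t ^ S.q / t := Real.rpow_sub_one ht0.ne' _
    obtain ⟨d, v, g, n, Δ, hΔ, hEb, hE'⟩ := S.exists_scalar_bounds hf_convex hf_smooth ht₀ hα hγ hc
      hp₀ hm_pos hm_diff hsol hsaddle ht2 hR0 (hRb t ht2.le) (fun τ hτ => hR t τ ht2.le hτ)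
      (hlx ht2).continuousAt (PDSystem.dualScale_pos ht₀ hq₀ hγ h)
      (fun τ hτ => PDSystem.coefA_nonneg ht₀ hq₀ hγ hk₂ (hT τ ((hTt ht).le.trans hτ)))
      (PDSystem.hasDerivAt_coefA_mul ht₀ hm_diff h) (PDSystem.hasDerivAt_coefB ht₀ hm_diff h)
      (hE.hasDerivAt ht2)
    have hβ : S.coefB t
        = -(S.α - 1) * (S.q * S.m t * (t ^ S.q / t) + S.mdot t * t ^ S.q - 1) := by
      rw [PDSystem.coefB, hq1]
    rw [hβ] at hEb hE'
    rw [hq1] at hE'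
    -- Since t ≥ 1, the rate with the maximal exponent is at most the rate for each of the two
    -- exponents.
    have hμ : ∀ e, e ≤ max S.q (S.p - S.q - S.s) →
        M / t ^ max S.q (S.p - S.q - S.s) ≤ M / t ^ e := fun e he =>
      div_le_div_of_nonneg_left hM₀.le (Real.rpow_pos_of_pos ht0 _)
        (Real.rpow_le_rpow_of_exponent_le h.large.ht he)
    have hμ₂ : M / t ^ max S.q (S.p - S.q - S.s) ≤ M * (t ^ S.q * t ^ S.s / t ^ S.p) := by
      refine (hμ _ (le_max_right _ _)).trans_eq ?_
      rw [Real.rpow_sub ht0, Real.rpow_sub ht0]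
      field_simp
    have key := LargeTime.energy_inequality hα hq₀ hγ hc hp₀ hk₁ hk₂ hM₀ hM₁ hM₂ h.large
      (by positivity) (hμ _ (le_max_left _ _)) hμ₂ hR0 (norm_nonneg S.A) hΔ rfl
      (by rw [S.dualScale_eq ht0, hq1])
      (by rw [S.coefA_eq ht0, hq1])
      (h.large.coefA_deriv_le hq₀ hq₁ hs hγ hk₁ hk₂)
      (h.large.coefB_deriv_le hα hq₀ hq₁ hk₂ hc) hEb hE'
    refine key.trans (mul_le_mul_of_nonneg_left ?_ ?_)
    · have hpow : t ^ (3 * S.q + S.s + S.p - 2)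
          = (t ^ S.q) ^ 3 * t ^ S.s * t ^ S.p / t ^ 2 := by
        rw [Real.rpow_sub ht0, Real.rpow_add ht0, Real.rpow_add ht0, mul_comm 3,
          Real.rpow_mul ht0.le]
        norm_cast
      rw [hpow]
      -- The first summand already bounds the error; only positivity of the second is needed.
      have := mul_pos h.large.hm (Real.rpow_pos_of_pos ht0 (S.q + S.s - S.p - 1))
      linarith
    · have : 0 < S.α - 1 := by linarith
      rw [LargeTime.errorConst]
      positivity
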